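/- Let $n\ge 1$ and let $\langle\cdot,\cdot\rangle$, $|\cdot|$ be the standard inner product and norm of $\mathbb R^n$. A convex body is a compact convex subset of $\mathbb R^n$ with non-empty interior; its support function is $h_K(v)=\max\{\langle v,y\rangle : y\in K\}$. Let $\partial' K$ be the set of those $x\in\partial K$ for which there is exactly one $v\in\mathbb S^{n-1}$ with $\langle x,v\rangle=h_K(v)$, and write $\nu_K(x)$ for this $v$ (the Gauss map $\nu_K:\partial'K\to\mathbb S^{n-1}$). For $p,q>0$, an origin-symmetric convex body $K$ and a Borel set $\eta\subset\mathbb S^{n-1}$, the $L_p$ Gaussian dual curvature measure is $$\widetilde C_{p,\gamma_n,q}(K,\eta)=\int_{\nu_K^{-1}(\eta)}\langle x,\nu_K(x)\rangle^{1-p}\,|x|^{q-n}\,e^{-|x|^2/2}\,d\mathcal H^{n-1}(x),$$ where $\mathcal H^{n-1}$ is $(n-1)$-dimensional Hausdorff measure; its total mass is $|\widetilde C_{p,\gamma_n,q}(K,\cdot)|=\widetilde C_{p,\gamma_n,q}(K,\mathbb S^{n-1})$. Theorem 1.1 (restated as Theorem 4.3). Let $p,q>0$ (in particular, any $p,q>1$),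 and let $\mu$ be a nonzero finite Borel measure on $\mathbb S^{n-1}$ which has an even density $f\ge 0$ with respect to the spherical Lebesgue measure, i.e. $d\mu=f\,dv$ and $f(-v)=f(v)$ for all $v\in\mathbb S^{n-1}$. Then there exists an origin-symmetric convex body $K$ in $\mathbb R^n$ such that $0<|\widetilde C_{p,\gamma_n,q}(K,\cdot)|<\infty$ and $$\frac{\mu}{|\mu|}=\frac{\widetilde C_{p,\gamma_n,q}(K,\cdot)}{|\widetilde C_{p,\gamma_n,q}(K,\cdot)|},\qquad |\mu|=\mu(\mathbb S^{n-1}).$$ -/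

import Mathlib

open MeasureTheory Metric
open scoped ENNReal

noncomputable section

/-- The support function `h_K(v) = max {⟨v, y⟩ : y ∈ K}` of a (nonempty, compact) set `K`. -/
def supportFn {n : ℕ} (K : Set (EuclideanSpace ℝ (Fin n))) (v : EuclideanSpace ℝ (Fin n)) : ℝ :=
  sSup ((fun y => inner ℝ v y) '' K)

/-- The supporting hyperplane `H_K(v) = {x : ⟨x, v⟩ = h_K(v)}`. -/
def supportingHyperplane {n : ℕ} (K : Set (EuclideanSpace ℝ (Fin n)))
    (v : EuclideanSpace ℝ (Fin n)) : Set (EuclideanSpace ℝ (Fin n)) :=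
  {x | inner ℝ x v = supportFn K v}

/-- The spherical image of a point: all unit vectors `v` with `x ∈ H_K(v)`. -/
def sphericalImage {n : ℕ} (K : Set (EuclideanSpace ℝ (Fin n)))
    (x : EuclideanSpace ℝ (Fin n)) : Set (EuclideanSpace ℝ (Fin n)) :=
  {v | v ∈ sphere (0 : EuclideanSpace ℝ (Fin n)) 1 ∧ x ∈ supportingHyperplane K v}

/-- The set `∂'K` of boundary points of `K` with exactly one outer unit normal. -/
def regularBoundary {n : ℕ} (K : Set (EuclideanSpace ℝ (Fin n))) :
    Set (EuclideanSpace ℝ (Fin n)) :=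
  {x | x ∈ frontier K ∧ ∃! v, v ∈ sphericalImage K x}

open Classical in
/-- The Gauss map `ν_K`: the outer unit normal at a point of `∂'K`
(with the irrelevant value `0` elsewhere). -/
def gaussMap {n : ℕ} (K : Set (EuclideanSpace ℝ (Fin n)))
    (x : EuclideanSpace ℝ (Fin n)) : EuclideanSpace ℝ (Fin n) :=
  if h : x ∈ regularBoundary K then h.2.choose else 0

/-- The inverse Gauss image `ν_K⁻¹(η) = {x ∈ ∂'K : ν_K(x) ∈ η}` of a set `η` on the sphere. -/
def inverseGaussImage {n : ℕ} (K : Set (EuclideanSpace ℝ (Fin n)))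
    (η : Set (sphere (0 : EuclideanSpace ℝ (Fin n)) 1)) : Set (EuclideanSpace ℝ (Fin n)) :=
  {x | x ∈ regularBoundary K ∧ gaussMap K x ∈ (Subtype.val '' η)}

/-- The `(n-1)`-dimensional Hausdorff measure on `ℝⁿ` in its usual normalization. Mathlib's
`μH[d]` weighs a covering set by `(diam)ᵈ`; the usual one weighs it by the volume of the
`d`-dimensional Euclidean ball of the same diameter. -/
def surfaceHausdorff (n : ℕ) : Measure (EuclideanSpace ℝ (Fin n)) :=
  volume (ball (0 : EuclideanSpace ℝ (Fin (n - 1))) (1 / 2)) •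
    Measure.hausdorffMeasure ((n : ℝ) - 1)

/-- The `L_p` Gaussian dual curvature measure
`C̃_{p,γ_n,q}(K, η) = ∫_{ν_K⁻¹(η)} ⟨x, ν_K(x)⟩^{1-p} |x|^{q-n} e^{-|x|²/2} dℋⁿ⁻¹(x)`
of a Borel set `η` on the sphere. -/
def lpGaussianDualCurvature {n : ℕ} (p q : ℝ) (K : Set (EuclideanSpace ℝ (Fin n)))
    (η : Set (sphere (0 : EuclideanSpace ℝ (Fin n)) 1)) : ℝ≥0∞ :=
  ∫⁻ x in inverseGaussImage K η,
    ENNReal.ofReal ((inner ℝ x (gaussMap K x)) ^ (1 - p) * ‖x‖ ^ (q - (n : ℝ)) *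
      Real.exp (-(‖x‖ ^ 2) / 2)) ∂(surfaceHausdorff n)

end

/-!
Among the symmetric convex bodies whose Gaussian dual volume `∫_K |z|^(q-n) e^(-|z|²/2) dz` is at
least that of a ball, minimize `∫ h_K^p dμ`. Since `μ` is not concentrated on a great subsphere, a
minimizing sequence is bounded, and Blaschke selection yields a minimizer. Perturbing `h_K` to
`h_K e^(tφ)` and passing to Wulff shapes, an Aleksandrov type variational formula gives the
Euler–Lagrange equation: `h_K^p μ` is proportional to the image under the Gauss map of a radially
weighted measure on the sphere. Finally, the boundary of `K` is nearly flat near a point with a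
unique normal `v`, so radial projection turns the cone measure of `K` into `h_K(v)` times surface
measure; this identifies the Euler–Lagrange equation with the statement about the `L_p` Gaussian
dual curvature measure.
-/

open Filter Topology Set
open scoped NNReal Pointwise

noncomputable section

section Gauge

section TopologicalPreliminaries

variable {X Y : Type*} [TopologicalSpace X] [TopologicalSpace Y] [CompactSpace Y]

theorem exists_pos_forall_le {f : Y → ℝ} (hf : Continuous f) (hpos : ∀ y, 0 < f y) :
    ∃ a, 0 < a ∧ ∀ y, a ≤ f y := by
  obtain ⟨a, ha, hle⟩ := isCompact_univ.exists_forall_le' hf.continuousOn fun y _ => hpos y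
  exact ⟨a, ha, fun y => hle y (mem_univ y)⟩

theorem exists_pos_forall_ge {f : Y → ℝ} (hf : Continuous f) :
    ∃ b, 0 < b ∧ ∀ y, f y ≤ b := by
  obtain ⟨b, hb⟩ := (isCompact_range hf).bddAbove
  exact ⟨max b 1, by positivity, fun y => (hb (mem_range_self y)).trans (le_max_left b 1)⟩

theorem eventually_forall_mem_of_isClosed {P : X → Y → Prop}
    (hP : IsClosed {a : X × Y | P a.1 a.2}) {x₀ : X} {W : Set Y} (hW : IsOpen W)
    (h : ∀ y, P x₀ y → y ∈ W) : ∀ᶠ x in 𝓝 x₀, ∀ y, P x y → y ∈ W := by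
  have hfiber : ∀ᶠ x in 𝓝 x₀, ∀ y ∈ Wᶜ, ¬ P x y :=
    hW.isClosed_compl.isCompact.eventually_forall_of_forall_eventually fun y hy =>
      hP.isOpen_compl.mem_nhds (x := (x₀, y)) fun hPy => hy (h y hPy)
  filter_upwards [hfiber] with x hx y hxy
  exact not_not.1 fun hy => hx y hy hxy

end TopologicalPreliminaries

variable {E : Type*} [NormedAddCommGroup E] [InnerProductSpace ℝ E]

theorem exists_unitSphere_inner_eq_norm {z : E} (hz : z ≠ 0) :
    ∃ v : sphere (0 : E) 1, inner ℝ z (v : E) = ‖z‖ := by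
  refine ⟨⟨‖z‖⁻¹ • z, by simp [norm_smul, hz]⟩, ?_⟩
  rw [real_inner_smul_right, real_inner_self_eq_norm_sq]
  field_simp [norm_ne_zero_iff.2 hz]

/-- The Wulff shape `[H] = {z : ⟨z, v⟩ ≤ H v for all unit vectors v}` of a function on the unit
sphere. -/
def wulffShape (H : sphere (0 : E) 1 → ℝ) : Set E :=
  {z | ∀ v : sphere (0 : E) 1, inner ℝ z (v : E) ≤ H v}

/-- The Minkowski gauge of the Wulff shape of a positive function `H`, written as the support
function of the polar body; its inverse is the radial function of the Wulff shape. -/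
def wulffGauge (H : sphere (0 : E) 1 → ℝ) (z : E) : ℝ :=
  ⨆ v : sphere (0 : E) 1, inner ℝ z (v : E) / H v

/-- The unit vector `v` attains the supremum defining `wulffGauge H z`, i.e. `v` is an outer normal
of the Wulff shape at the boundary point on the ray through `z`, and `H v` is the support function
there. -/
def IsNormalDir (H : sphere (0 : E) 1 → ℝ) (z : E) (v : sphere (0 : E) 1) : Prop :=
  inner ℝ z (v : E) = wulffGauge H z * H v

/-- The nonzero vectors with exactly one normal direction. -/
def regularDirs (H : sphere (0 : E) 1 → ℝ) : Set E :=
  {z | z ≠ 0 ∧ ∃! v, IsNormalDir H z v}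

open Classical in
/-- A choice of outer unit normal of the Wulff shape in the direction `z`; it is canonical on
`regularDirs H`. -/
def wulffNormal [Nontrivial E] (H : sphere (0 : E) 1 → ℝ) (z : E) : sphere (0 : E) 1 :=
  haveI : Nonempty (sphere (0 : E) 1) := (NormedSpace.sphere_nonempty.2 zero_le_one).to_subtype
  Classical.epsilon (IsNormalDir H z)

variable {H : sphere (0 : E) 1 → ℝ}

theorem isClosed_wulffShape : IsClosed (wulffShape H) := by
  simp only [wulffShape, ofPred_forall]
  exact isClosed_iInter fun v => isClosed_le (by fun_prop) continuous_const

theorem convex_wulffShape : Convex ℝ (wulffShape H) := by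
  simp only [wulffShape, ofPred_forall]
  refine convex_iInter fun v => convex_halfSpace_le (IsLinearMap.mk ?_ ?_) (H v)
  · exact fun x y => inner_add_left x y _
  · exact fun c x => real_inner_smul_left x _ c

theorem neg_mem_wulffShape (heven : ∀ v, H (-v) = H v) {x : E} (hx : x ∈ wulffShape H) :
    -x ∈ wulffShape H := fun v => by
  simpa [heven] using hx (-v)

theorem wulffGauge_zero : wulffGauge H (0 : E) = 0 := by
  simp [wulffGauge]

theorem wulffGauge_smul {c : ℝ} (hc : 0 ≤ c) (z : E) :
    wulffGauge H (c • z) = c * wulffGauge H z := by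
  simp only [wulffGauge, real_inner_smul_left, mul_div_assoc]
  exact (Real.mul_iSup_of_nonneg hc _).symm

theorem wulffGauge_neg (heven : ∀ v, H (-v) = H v) (z : E) :
    wulffGauge H (-z) = wulffGauge H z := by
  rw [wulffGauge, wulffGauge, ← (Equiv.neg (sphere (0 : E) 1)).iSup_comp]
  simp [heven]

theorem isNormalDir_smul_iff {c : ℝ} (hc : 0 < c) {z : E} {v : sphere (0 : E) 1} :
    IsNormalDir H (c • z) v ↔ IsNormalDir H z v := by
  simp only [IsNormalDir, real_inner_smul_left, wulffGauge_smul hc.le, mul_assoc]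
  exact mul_right_inj' hc.ne'

theorem isNormalDir_neg_iff (heven : ∀ v, H (-v) = H v) {z : E} {v : sphere (0 : E) 1} :
    IsNormalDir H (-z) (-v) ↔ IsNormalDir H z v := by
  simp [IsNormalDir, wulffGauge_neg heven, heven]

theorem smul_mem_regularDirs_iff {c : ℝ} (hc : 0 < c) {z : E} :
    c • z ∈ regularDirs H ↔ z ∈ regularDirs H := by
  simp [regularDirs, isNormalDir_smul_iff hc, hc.ne']

theorem neg_mem_regularDirs (heven : ∀ v, H (-v) = H v) {z : E} (hz : z ∈ regularDirs H) :
    -z ∈ regularDirs H := by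
  obtain ⟨hz0, v, hv, hunique⟩ := hz
  refine ⟨neg_ne_zero.2 hz0, -v, (isNormalDir_neg_iff heven).2 hv, fun w hw => ?_⟩
  rw [← hunique (-w) ((isNormalDir_neg_iff heven).1 (by simpa using hw)), neg_neg]

theorem inv_smul_coe_injective (hpos : ∀ v, 0 < H v) :
    Function.Injective fun v : sphere (0 : E) 1 => (H v)⁻¹ • (v : E) := by
  intro v w (hvw : (H v)⁻¹ • (v : E) = (H w)⁻¹ • (w : E))
  have hnorm : (H v)⁻¹ = (H w)⁻¹ := by
    simpa [norm_smul, abs_of_pos (hpos v), abs_of_pos (hpos w)] using congrArg norm hvw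
  rw [hnorm] at hvw
  exact Subtype.ext (smul_right_injective E (inv_pos.2 (hpos w)).ne' hvw)

theorem continuous_inner_div (hH : Continuous H) (hpos : ∀ v, 0 < H v) (z : E) :
    Continuous fun v : sphere (0 : E) 1 => inner ℝ z (v : E) / H v :=
  (continuous_const.inner continuous_subtype_val).div hH fun v => (hpos v).ne'

variable [FiniteDimensional ℝ E]

theorem inner_div_le_wulffGauge (hH : Continuous H) (hpos : ∀ v, 0 < H v) (z : E)
    (v : sphere (0 : E) 1) : inner ℝ z (v : E) / H v ≤ wulffGauge H z :=
  le_ciSup (isCompact_range (continuous_inner_div hH hpos z)).bddAbove v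

theorem inner_le_wulffGauge_mul (hH : Continuous H) (hpos : ∀ v, 0 < H v) (z : E)
    (v : sphere (0 : E) 1) : inner ℝ z (v : E) ≤ wulffGauge H z * H v :=
  (div_le_iff₀ (hpos v)).1 (inner_div_le_wulffGauge hH hpos z v)

theorem wulffGauge_pos (hH : Continuous H) (hpos : ∀ v, 0 < H v) {z : E} (hz : z ≠ 0) :
    0 < wulffGauge H z := by
  obtain ⟨v, hv⟩ := exists_unitSphere_inner_eq_norm hz
  refine lt_of_lt_of_le ?_ (inner_div_le_wulffGauge hH hpos z v)
  rw [hv]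
  exact div_pos (norm_pos_iff.2 hz) (hpos v)

theorem wulffGauge_nonneg (hH : Continuous H) (hpos : ∀ v, 0 < H v) (z : E) :
    0 ≤ wulffGauge H z := by
  rcases eq_or_ne z 0 with rfl | hz
  · rw [wulffGauge_zero]
  · exact (wulffGauge_pos hH hpos hz).le

theorem wulffGauge_coe_pos (hH : Continuous H) (hpos : ∀ v, 0 < H v) (u : sphere (0 : E) 1) :
    0 < wulffGauge H (u : E) :=
  wulffGauge_pos hH hpos (ne_zero_of_mem_unit_sphere u)

theorem norm_le_mul_wulffGauge (hH : Continuous H) (hpos : ∀ v, 0 < H v) {b : ℝ}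
    (hb : ∀ v, H v ≤ b) (z : E) : ‖z‖ ≤ b * wulffGauge H z := by
  rcases eq_or_ne z 0 with rfl | hz
  · simp [wulffGauge_zero]
  obtain ⟨v, hv⟩ := exists_unitSphere_inner_eq_norm hz
  calc ‖z‖ = inner ℝ z (v : E) := hv.symm
    _ ≤ wulffGauge H z * H v := inner_le_wulffGauge_mul hH hpos z v
    _ ≤ wulffGauge H z * b := by gcongr; exacts [wulffGauge_nonneg hH hpos z, hb v]
    _ = b * wulffGauge H z := mul_comm _ _

theorem IsNormalDir.subgradient (hH : Continuous H) (hpos : ∀ v, 0 < H v) {z : E}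
    {v : sphere (0 : E) 1} (hv : IsNormalDir H z v) (w : E) :
    wulffGauge H z - wulffGauge H w ≤ inner ℝ (z - w) ((H v)⁻¹ • (v : E)) := by
  have hw := inner_div_le_wulffGauge hH hpos w v
  rw [IsNormalDir, ← div_eq_iff (hpos v).ne'] at hv
  rw [real_inner_smul_right, inner_sub_left, mul_sub, inv_mul_eq_div, inv_mul_eq_div, hv]
  linarith

theorem IsNormalDir.fderiv_wulffGauge (hH : Continuous H) (hpos : ∀ v, 0 < H v) {z : E}
    {v : sphere (0 : E) 1} (hv : IsNormalDir H z v) (hd : DifferentiableAt ℝ (wulffGauge H) z) :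
    fderiv ℝ (wulffGauge H) z = innerSL ℝ ((H v)⁻¹ • (v : E)) := by
  have hmin : IsLocalMin (fun w => wulffGauge H w - innerSL ℝ ((H v)⁻¹ • (v : E)) w) z := by
    refine Eventually.of_forall fun w => ?_
    have hsub := hv.subgradient hH hpos w
    rw [inner_sub_left, real_inner_comm, real_inner_comm _ w] at hsub
    simp only [innerSL_apply_apply]
    linarith
  exact sub_eq_zero.1 (hmin.hasFDerivAt_eq_zero
    (hd.hasFDerivAt.sub (innerSL ℝ ((H v)⁻¹ • (v : E))).hasFDerivAt))

variable [Nontrivial E]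

theorem exists_isNormalDir (hH : Continuous H) (hpos : ∀ v, 0 < H v) (z : E) :
    ∃ v, IsNormalDir H z v := by
  have : Nonempty (sphere (0 : E) 1) := (NormedSpace.sphere_nonempty.2 zero_le_one).to_subtype
  obtain ⟨v, -, hv⟩ := isCompact_univ.exists_isMaxOn univ_nonempty
    (continuous_inner_div hH hpos z).continuousOn
  refine ⟨v, ?_⟩
  rw [IsNormalDir, ← div_eq_iff (hpos v).ne']
  exact le_antisymm (inner_div_le_wulffGauge hH hpos z v) (ciSup_le fun w => hv (mem_univ w))

theorem mem_wulffShape_iff (hH : Continuous H) (hpos : ∀ v, 0 < H v) {z : E} :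
    z ∈ wulffShape H ↔ wulffGauge H z ≤ 1 := by
  constructor
  · intro hz
    obtain ⟨v, hv⟩ := exists_isNormalDir hH hpos z
    rw [IsNormalDir, ← div_eq_iff (hpos v).ne'] at hv
    rw [← hv, div_le_one (hpos v)]
    exact hz v
  · exact fun hz v => (inner_le_wulffGauge_mul hH hpos z v).trans
      (mul_le_of_le_one_left (hpos v).le hz)

theorem wulffGauge_sub_le (hH : Continuous H) (hpos : ∀ v, 0 < H v) {a : ℝ}
    (ha : 0 < a) (hle : ∀ v, a ≤ H v) (z w : E) :
    wulffGauge H z - wulffGauge H w ≤ a⁻¹ * ‖z - w‖ := by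
  obtain ⟨v, hv⟩ := exists_isNormalDir hH hpos z
  calc wulffGauge H z - wulffGauge H w ≤ inner ℝ (z - w) ((H v)⁻¹ • (v : E)) :=
        hv.subgradient hH hpos w
    _ ≤ ‖z - w‖ * ‖(H v)⁻¹ • (v : E)‖ := real_inner_le_norm _ _
    _ = (H v)⁻¹ * ‖z - w‖ := by
        rw [norm_smul, norm_eq_of_mem_sphere, mul_one, norm_inv, Real.norm_of_nonneg (hpos v).le,
          mul_comm]
    _ ≤ a⁻¹ * ‖z - w‖ := by gcongr; exact hle v

theorem exists_lipschitzWith_wulffGauge (hH : Continuous H) (hpos : ∀ v, 0 < H v) :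
    ∃ C, LipschitzWith C (wulffGauge H) := by
  obtain ⟨a, ha, hle⟩ := exists_pos_forall_le hH hpos
  refine ⟨⟨a⁻¹, by positivity⟩, LipschitzWith.of_dist_le_mul fun z w => ?_⟩
  rw [Real.dist_eq, abs_sub_le_iff, dist_eq_norm]
  refine ⟨wulffGauge_sub_le hH hpos ha hle z w, ?_⟩
  rw [norm_sub_rev]
  exact wulffGauge_sub_le hH hpos ha hle w z

theorem continuous_wulffGauge (hH : Continuous H) (hpos : ∀ v, 0 < H v) :
    Continuous (wulffGauge H) :=
  (exists_lipschitzWith_wulffGauge hH hpos).choose_spec.continuous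

theorem continuous_wulffGauge_coe (hH : Continuous H) (hpos : ∀ v, 0 < H v) :
    Continuous fun u : sphere (0 : E) 1 => wulffGauge H (u : E) :=
  (continuous_wulffGauge hH hpos).comp continuous_subtype_val

theorem continuous_inv_wulffGauge_coe (hH : Continuous H) (hpos : ∀ v, 0 < H v) :
    Continuous fun u : sphere (0 : E) 1 => (wulffGauge H (u : E))⁻¹ :=
  (continuous_wulffGauge_coe hH hpos).inv₀ fun u => (wulffGauge_coe_pos hH hpos u).ne'

theorem isClosed_isNormalDir (hH : Continuous H) (hpos : ∀ v, 0 < H v) :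
    IsClosed {a : E × sphere (0 : E) 1 | IsNormalDir H a.1 a.2} :=
  isClosed_eq (continuous_fst.inner (continuous_subtype_val.comp continuous_snd))
    (((continuous_wulffGauge hH hpos).comp continuous_fst).mul (hH.comp continuous_snd))

theorem isNormalDir_wulffNormal (hH : Continuous H) (hpos : ∀ v, 0 < H v) (z : E) :
    IsNormalDir H z (wulffNormal H z) :=
  Classical.epsilon_spec (exists_isNormalDir hH hpos z)

theorem wulffNormal_eq (hH : Continuous H) (hpos : ∀ v, 0 < H v) {z : E}
    (hz : z ∈ regularDirs H) {v : sphere (0 : E) 1} (hv : IsNormalDir H z v) :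
    wulffNormal H z = v :=
  hz.2.unique (isNormalDir_wulffNormal hH hpos z) hv

theorem wulffNormal_smul (hH : Continuous H) (hpos : ∀ v, 0 < H v) {z : E}
    (hz : z ∈ regularDirs H) {c : ℝ} (hc : 0 < c) : wulffNormal H (c • z) = wulffNormal H z :=
  wulffNormal_eq hH hpos ((smul_mem_regularDirs_iff hc).2 hz)
    ((isNormalDir_smul_iff hc).2 (isNormalDir_wulffNormal hH hpos z))

theorem wulffNormal_neg (hH : Continuous H) (hpos : ∀ v, 0 < H v)
    (heven : ∀ v, H (-v) = H v) {z : E} (hz : z ∈ regularDirs H) :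
    wulffNormal H (-z) = -wulffNormal H z :=
  wulffNormal_eq hH hpos (neg_mem_regularDirs heven hz)
    ((isNormalDir_neg_iff heven).2 (isNormalDir_wulffNormal hH hpos z))

theorem eventually_forall_isNormalDir_mem (hH : Continuous H) (hpos : ∀ v, 0 < H v) {z : E}
    (hz : z ∈ regularDirs H) {W : Set (sphere (0 : E) 1)} (hW : W ∈ 𝓝 (wulffNormal H z)) :
    ∀ᶠ w in 𝓝 z, ∀ v, IsNormalDir H w v → v ∈ W := by
  have hinterior : ∀ᶠ w in 𝓝 z, ∀ v, IsNormalDir H w v → v ∈ interior W := by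
    refine eventually_forall_mem_of_isClosed (isClosed_isNormalDir hH hpos) isOpen_interior ?_
    intro v hv
    rw [← wulffNormal_eq hH hpos hz hv]
    exact mem_interior_iff_mem_nhds.2 hW
  filter_upwards [hinterior] with w hw v hv using interior_subset (hw v hv)

theorem continuousAt_wulffNormal (hH : Continuous H) (hpos : ∀ v, 0 < H v) {z : E}
    (hz : z ∈ regularDirs H) : ContinuousAt (wulffNormal H) z := by
  refine fun W hW => mem_map.2 ?_
  filter_upwards [eventually_forall_isNormalDir_mem hH hpos hz hW] with w hw
  exact hw _ (isNormalDir_wulffNormal hH hpos w)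

theorem continuousOn_wulffNormal (hH : Continuous H) (hpos : ∀ v, 0 < H v) :
    ContinuousOn (wulffNormal H) (regularDirs H) := fun _ hz =>
  (continuousAt_wulffNormal hH hpos hz).continuousWithinAt

theorem mem_regularDirs_of_differentiableAt (hH : Continuous H) (hpos : ∀ v, 0 < H v) {z : E}
    (hz : z ≠ 0) (hd : DifferentiableAt ℝ (wulffGauge H) z) : z ∈ regularDirs H := by
  obtain ⟨v, hv⟩ := exists_isNormalDir hH hpos z
  refine ⟨hz, v, hv, fun w hw => inv_smul_coe_injective hpos ((innerSL_inj (𝕜 := ℝ)).1 ?_)⟩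
  exact (hw.fderiv_wulffGauge hH hpos hd).symm.trans (hv.fderiv_wulffGauge hH hpos hd)

theorem hasFDerivAt_wulffGauge (hH : Continuous H) (hpos : ∀ v, 0 < H v) {z : E}
    (hz : z ∈ regularDirs H) :
    HasFDerivAt (wulffGauge H)
      (innerSL ℝ ((H (wulffNormal H z))⁻¹ • (wulffNormal H z : E))) z := by
  set N : E → E := fun w => (H (wulffNormal H w))⁻¹ • (wulffNormal H w : E)
  have hcont : ContinuousAt N z :=
    (((hH.inv₀ fun v => (hpos v).ne').smul continuous_subtype_val).continuousAt).comp
      (continuousAt_wulffNormal hH hpos hz)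
  have hlim : Tendsto (fun w => ‖N w - N z‖) (𝓝 z) (𝓝 0) :=
    tendsto_iff_norm_sub_tendsto_zero.1 hcont
  refine .of_isLittleO (Asymptotics.isLittleO_iff.2 fun ε hε => ?_)
  filter_upwards [hlim.eventually (gt_mem_nhds hε)] with w hw
  -- the remainder lies between `0` and `⟪w - z, N w - N z⟫`
  have hlower := (isNormalDir_wulffNormal hH hpos z).subgradient hH hpos w
  have hupper := (isNormalDir_wulffNormal hH hpos w).subgradient hH hpos z
  have hcs : inner ℝ (w - z) (N w - N z) ≤ ε * ‖w - z‖ :=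
    (real_inner_le_norm _ _).trans (by rw [mul_comm]; gcongr)
  rw [← neg_sub w z, inner_neg_left] at hlower
  rw [inner_sub_right] at hcs
  rw [innerSL_apply_apply, real_inner_comm, Real.norm_eq_abs, abs_le]
  constructor
  · nlinarith [norm_nonneg (w - z)]
  · linarith

theorem mem_regularDirs_iff_differentiableAt (hH : Continuous H) (hpos : ∀ v, 0 < H v) {z : E}
    (hz : z ≠ 0) : z ∈ regularDirs H ↔ DifferentiableAt ℝ (wulffGauge H) z :=
  ⟨fun h => (hasFDerivAt_wulffGauge hH hpos h).differentiableAt,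
    mem_regularDirs_of_differentiableAt hH hpos hz⟩

variable [MeasurableSpace E] [BorelSpace E]

theorem measurableSet_regularDirs (hH : Continuous H) (hpos : ∀ v, 0 < H v) :
    MeasurableSet (regularDirs H) := by
  have heq : regularDirs H = {z | DifferentiableAt ℝ (wulffGauge H) z} \ {0} := by
    ext z
    rcases eq_or_ne z 0 with rfl | hz
    · simp [regularDirs]
    · simp [mem_regularDirs_iff_differentiableAt hH hpos hz, hz]
  rw [heq]
  exact (measurableSet_of_differentiableAt ℝ _).diff (measurableSet_singleton 0)

theorem ae_mem_regularDirs (hH : Continuous H) (hpos : ∀ v, 0 < H v)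
    (μ : Measure E) [μ.IsAddHaarMeasure] : ∀ᵐ z ∂μ, z ∈ regularDirs H := by
  obtain ⟨C, hC⟩ := exists_lipschitzWith_wulffGauge hH hpos
  filter_upwards [hC.ae_differentiableAt (μ := μ), Measure.ae_ne μ 0] with z hd hz
  exact mem_regularDirs_of_differentiableAt hH hpos hz hd

end Gauge

section EuclideanHausdorff

section HausdorffComparison

variable {X Y : Type*} [EMetricSpace X] [MeasurableSpace X] [BorelSpace X]
  [EMetricSpace Y] [MeasurableSpace Y] [BorelSpace Y] {K : ℝ≥0} {f : X → Y} {s : Set X}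

theorem euclideanHausdorffMeasure_image_le (hf : LipschitzOnWith K f s) (d : ℕ) :
    μHE[d] (f '' s) ≤ (K : ℝ≥0∞) ^ d * μHE[d] s := by
  simp only [Measure.euclideanHausdorffMeasure_def, Measure.smul_apply]
  rw [mul_smul_comm]
  gcongr
  simpa using hf.hausdorffMeasure_image_le (d := d) (by positivity)

theorem euclideanHausdorffMeasure_le_image (hf : AntilipschitzWith K (s.domRestrict f)) (d : ℕ) :
    μHE[d] s ≤ (K : ℝ≥0∞) ^ d * μHE[d] (f '' s) := by
  simp only [Measure.euclideanHausdorffMeasure_def, Measure.smul_apply]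
  rw [mul_smul_comm]
  gcongr
  have hs : Measure.hausdorffMeasure d (univ : Set s) = Measure.hausdorffMeasure d s := by
    rw [← isometry_subtype_coe.hausdorffMeasure_image (Or.inl d.cast_nonneg), image_univ,
      Subtype.range_coe]
  have himage := hf.le_hausdorffMeasure_image d.cast_nonneg univ
  rwa [hs, image_univ, range_domRestrict, ENNReal.rpow_natCast] at himage

end HausdorffComparison

theorem measure_le_of_locally_le {X : Type*} [TopologicalSpace X] [SecondCountableTopology X]
    [MeasurableSpace X] [BorelSpace X] {μ ν : Measure X} {R : Set X}
    (h : ∀ x ∈ R, ∃ V ∈ 𝓝 x, ∀ A ⊆ R ∩ V, MeasurableSet A → μ A ≤ ν A) {A : Set X}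
    (hAR : A ⊆ R) (hA : MeasurableSet A) : μ A ≤ ν A := by
  choose! V hV hle using h
  obtain ⟨t, htR, htc, hcover⟩ := TopologicalSpace.countable_cover_nhdsWithin
    (f := fun x => interior (V x)) (s := R)
    (fun x hx => mem_nhdsWithin_of_mem_nhds (interior_mem_nhds.2 (hV x hx)))
  rcases t.eq_empty_or_nonempty with rfl | hne
  · have hempty : A = ∅ := by simpa using hAR.trans hcover
    simp [hempty]
  obtain ⟨f, rfl⟩ := htc.exists_eq_range hne
  let U : ℕ → Set X := fun i => interior (V (f i))
  have hU : ∀ i, MeasurableSet (A ∩ disjointed U i) := fun i =>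
    hA.inter (MeasurableSet.disjointed (fun i => isOpen_interior.measurableSet) i)
  have hdecomp : A = ⋃ i, A ∩ disjointed U i := by
    rw [← inter_iUnion, iUnion_disjointed, inter_eq_left.2]
    intro x hx
    simpa [U] using hcover (hAR hx)
  have hdisj : Pairwise (Function.onFun Disjoint fun i => A ∩ disjointed U i) := fun i j hij =>
    (disjoint_disjointed U hij).mono inter_subset_right inter_subset_right
  rw [hdecomp, measure_iUnion hdisj hU, measure_iUnion hdisj hU]
  refine ENNReal.tsum_le_tsum fun i => hle (f i) (htR ⟨i, rfl⟩) _ ?_ (hU i)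
  exact inter_subset_inter hAR ((disjointed_subset U i).trans interior_subset)

theorem ennreal_le_of_forall_le_pow_mul {a b : ℝ≥0∞} (m : ℕ)
    (h : ∀ K : ℝ≥0, 1 < K → a ≤ (K : ℝ≥0∞) ^ m * b) : a ≤ b := by
  have hlim : Tendsto (fun K : ℝ≥0 => (K : ℝ≥0∞) ^ m * b) (𝓝[>] 1)
      (𝓝 (((1 : ℝ≥0) : ℝ≥0∞) ^ m * b)) := by
    refine ENNReal.Tendsto.mul_const ?_ (Or.inl (by simp))
    exact ((ENNReal.continuous_pow m).comp ENNReal.continuous_coe).continuousAt.mono_left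
      nhdsWithin_le_nhds
  simp only [ENNReal.coe_one, one_pow, one_mul] at hlim
  exact ge_of_tendsto hlim (eventually_mem_nhdsWithin.mono fun K hK => h K hK)

section NearIdentity

variable {E : Type*} [NormedAddCommGroup E] {ε : ℝ} {K : ℝ≥0} {f : E → E} {s : Set E}

theorem lipschitzOnWith_of_norm_sub_sub_le (hK : 1 + ε ≤ K)
    (hf : ∀ z ∈ s, ∀ w ∈ s, ‖(f z - f w) - (z - w)‖ ≤ ε * ‖z - w‖) :
    LipschitzOnWith K f s := by
  refine LipschitzOnWith.of_dist_le_mul fun z hz w hw => ?_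
  rw [dist_eq_norm, dist_eq_norm]
  have htri := norm_add_le ((f z - f w) - (z - w)) (z - w)
  rw [sub_add_cancel] at htri
  nlinarith [norm_nonneg (z - w), hf z hz w hw]

theorem antilipschitzWith_domRestrict_of_norm_sub_sub_le (hK : 1 ≤ K * (1 - ε))
    (hf : ∀ z ∈ s, ∀ w ∈ s, ‖(f z - f w) - (z - w)‖ ≤ ε * ‖z - w‖) :
    AntilipschitzWith K (s.domRestrict f) := by
  refine AntilipschitzWith.of_le_mul_dist fun ⟨z, hz⟩ ⟨w, hw⟩ => ?_
  rw [Subtype.dist_eq, domRestrict_apply, domRestrict_apply, dist_eq_norm, dist_eq_norm]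
  have htri := norm_sub_norm_le (z - w) (f z - f w)
  rw [norm_sub_rev (z - w)] at htri
  have hbound : (1 - ε) * ‖z - w‖ ≤ ‖f z - f w‖ := by linarith [hf z hz w hw]
  nlinarith [norm_nonneg (z - w), K.coe_nonneg]

theorem exists_pos_one_add_le_and_one_le_mul_one_sub (hK : 1 < K) :
    ∃ ε : ℝ, 0 < ε ∧ 1 + ε ≤ K ∧ 1 ≤ K * (1 - ε) := by
  have hK' : (1 : ℝ) < K := by exact_mod_cast hK
  refine ⟨1 - (K : ℝ)⁻¹, sub_pos.2 (inv_lt_one_of_one_lt₀ hK'), ?_, by field_simp; simp⟩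
  have hsq : (K : ℝ) + (K : ℝ)⁻¹ - 2 = (K - 1) ^ 2 / K := by field_simp; ring
  have hnonneg : 0 ≤ ((K : ℝ) - 1) ^ 2 / K := by positivity
  linarith

end NearIdentity

variable {E : Type*} [NormedAddCommGroup E] [InnerProductSpace ℝ E]

section FlatCone

variable {v : sphere (0 : E) 1} {h : ℝ} {B : Set E}

theorem mem_Ioc_smul_iff_of_inner_eq (hh : 0 < h) (hB : ∀ y ∈ B, inner ℝ y (v : E) = h) {y : E} :
    y ∈ Ioc (0 : ℝ) 1 • B ↔
      inner ℝ y (v : E) ∈ Ioc 0 h ∧ (h / inner ℝ y (v : E)) • y ∈ B := by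
  constructor
  · rintro ⟨t, ⟨ht0, ht1⟩, b, hb, rfl⟩
    have hinner : inner ℝ (t • b) (v : E) = t * h := by rw [real_inner_smul_left, hB b hb]
    simp only [hinner, smul_smul]
    refine ⟨⟨by positivity, mul_le_of_le_one_left hh.le ht1⟩, ?_⟩
    rwa [div_mul_eq_mul_div, mul_comm h, div_self (by positivity), one_smul]
  · rintro ⟨⟨hy0, hyh⟩, hy⟩
    refine ⟨inner ℝ y (v : E) / h, ⟨by positivity, (div_le_one hh).2 hyh⟩, _, hy, ?_⟩
    simp only [smul_smul]
    rw [div_mul_div_cancel₀ hh.ne', div_self hy0.ne', one_smul]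

theorem measurableSet_Ioc_smul_of_inner_eq [FiniteDimensional ℝ E] [MeasurableSpace E]
    [BorelSpace E] (hh : 0 < h) (hBm : MeasurableSet B)
    (hB : ∀ y ∈ B, inner ℝ y (v : E) = h) : MeasurableSet (Ioc (0 : ℝ) 1 • B) := by
  have heq : Ioc (0 : ℝ) 1 • B =
      {y | inner ℝ y (v : E) ∈ Ioc 0 h} ∩ {y | (h / inner ℝ y (v : E)) • y ∈ B} := by
    ext y
    exact mem_Ioc_smul_iff_of_inner_eq hh hB
  have hinner : Measurable fun y : E => inner ℝ y (v : E) :=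
    (continuous_id.inner continuous_const).measurable
  rw [heq]
  exact (hinner measurableSet_Ioc).inter (((measurable_const.div hinner).smul measurable_id) hBm)

theorem lintegral_Ioc_ofReal_div_pow (hh : 0 < h) (k : ℕ) :
    ∫⁻ s in Ioc 0 h, ENNReal.ofReal ((s / h) ^ k) = ENNReal.ofReal (h / (k + 1)) := by
  rw [← ofReal_integral_eq_lintegral_ofReal]
  · congr 1
    rw [← intervalIntegral.integral_of_le hh.le]
    simp_rw [div_pow]
    rw [intervalIntegral.integral_div, integral_pow]
    field_simp
    simp [pow_succ]
  · exact (Continuous.integrableOn_Icc (by fun_prop)).mono_set Ioc_subset_Icc_self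
  · filter_upwards [ae_restrict_mem measurableSet_Ioc] with s hs
    have := hs.1
    simp only [Pi.zero_apply]
    positivity

theorem exists_linearIsometryEquiv_prod_real [FiniteDimensional ℝ E] {k : ℕ}
    (hE : Module.finrank ℝ E = k + 1) (v : sphere (0 : E) 1) :
    ∃ T : WithLp 2 (EuclideanSpace ℝ (Fin k) × ℝ) ≃ₗᵢ[ℝ] E, T (WithLp.toLp 2 (0, 1)) = v := by
  have hX : Module.finrank ℝ (WithLp 2 (EuclideanSpace ℝ (Fin k) × ℝ)) = k + 1 := by
    rw [(WithLp.linearEquiv 2 ℝ _).finrank_eq]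
    simp
  let T₀ : WithLp 2 (EuclideanSpace ℝ (Fin k) × ℝ) ≃ₗᵢ[ℝ] E :=
    (stdOrthonormalBasis ℝ _).equiv (stdOrthonormalBasis ℝ E) (finCongr (hX.trans hE.symm))
  -- the reflection in the bisecting hyperplane carries the image of the last axis to `v`
  refine ⟨T₀.trans ((ℝ ∙ (T₀ (WithLp.toLp 2 (0, 1)) - (v : E)))ᗮ.reflection), ?_⟩
  rw [LinearIsometryEquiv.trans_apply]
  apply Submodule.reflection_sub
  rw [LinearIsometryEquiv.norm_map, norm_eq_of_mem_sphere, ← sq_eq_sq₀ (norm_nonneg _) zero_le_one,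
    WithLp.prod_norm_sq_eq_of_L2]
  simp

section Slices

variable {k : ℕ} {T : WithLp 2 (EuclideanSpace ℝ (Fin k) × ℝ) ≃ₗᵢ[ℝ] E}

theorem inner_apply_toLp (hT : T (WithLp.toLp 2 (0, 1)) = v) (x : EuclideanSpace ℝ (Fin k) × ℝ) :
    inner ℝ (T (WithLp.toLp 2 x)) (v : E) = x.2 := by
  rw [← hT, T.inner_map_map, WithLp.prod_inner_apply]
  simp

theorem euclideanHausdorffMeasure_eq_volume_slice [MeasurableSpace E] [BorelSpace E]
    (hT : T (WithLp.toLp 2 (0, 1)) = v) (hB : ∀ y ∈ B, inner ℝ y (v : E) = h) :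
    μHE[k] B = volume ((fun x => T (WithLp.toLp 2 (x, h))) ⁻¹' B) := by
  have hiso : Isometry fun x => T (WithLp.toLp 2 (x, h)) := T.isometry.comp <|
    Isometry.of_dist_eq fun x y => by
      rw [WithLp.prod_dist_eq_of_L2]
      simp [Real.sqrt_sq dist_nonneg]
  rw [← EuclideanSpace.euclideanHausdorffMeasure_eq_volume,
    hiso.euclideanHausdorffMeasure_preimage, inter_eq_left.2 fun y hy => ?_]
  obtain ⟨x, rfl⟩ : ∃ x, T (WithLp.toLp 2 x) = y := ⟨(T.symm y).ofLp, by simp⟩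
  exact ⟨x.1, by rw [← hB _ hy, inner_apply_toLp hT]⟩

theorem volume_slice_Ioc_smul [MeasurableSpace E] [BorelSpace E]
    (hT : T (WithLp.toLp 2 (0, 1)) = v) (hh : 0 < h) (hB : ∀ y ∈ B, inner ℝ y (v : E) = h)
    (s : ℝ) : volume ((fun x => T (WithLp.toLp 2 (x, s))) ⁻¹' (Ioc (0 : ℝ) 1 • B)) =
      (Ioc 0 h).indicator (fun s => ENNReal.ofReal ((s / h) ^ k) * μHE[k] B) s := by
  by_cases hs : s ∈ Ioc 0 h
  · have hratio : 0 < h / s := div_pos hh hs.1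
    have heq : (fun x => T (WithLp.toLp 2 (x, s))) ⁻¹' (Ioc (0 : ℝ) 1 • B) =
        (fun x => (h / s) • x) ⁻¹' ((fun x => T (WithLp.toLp 2 (x, h))) ⁻¹' B) := by
      ext x
      simp [mem_Ioc_smul_iff_of_inner_eq hh hB, inner_apply_toLp hT, ← map_smul,
        ← WithLp.toLp_smul, hs.1, hs.2, hs.1.ne']
    rw [heq, Measure.addHaar_preimage_smul _ hratio.ne', indicator_of_mem hs,
      finrank_euclideanSpace_fin, abs_of_pos (by positivity), ← inv_pow, inv_div,
      euclideanHausdorffMeasure_eq_volume_slice hT hB]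
  · have heq : (fun x => T (WithLp.toLp 2 (x, s))) ⁻¹' (Ioc (0 : ℝ) 1 • B) = ∅ :=
      eq_empty_of_forall_notMem fun x hx => hs <| by
        simpa only [inner_apply_toLp hT] using ((mem_Ioc_smul_iff_of_inner_eq hh hB).1 hx).1
    rw [heq, measure_empty, indicator_of_notMem hs]

end Slices

theorem volume_Ioc_smul_of_inner_eq [FiniteDimensional ℝ E] [MeasurableSpace E] [BorelSpace E]
    {k : ℕ} (hE : Module.finrank ℝ E = k + 1) (hh : 0 < h) (hBm : MeasurableSet B)
    (hB : ∀ y ∈ B, inner ℝ y (v : E) = h) :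
    volume (Ioc (0 : ℝ) 1 • B) = ENNReal.ofReal (h / (k + 1)) * μHE[k] B := by
  obtain ⟨T, hT⟩ := exists_linearIsometryEquiv_prod_real hE v
  have hcoord : MeasurePreserving fun x : EuclideanSpace ℝ (Fin k) × ℝ => T (WithLp.toLp 2 x) :=
    T.measurePreserving.comp (WithLp.volume_preserving_toLp (EuclideanSpace ℝ (Fin k)) ℝ)
  have hcone := measurableSet_Ioc_smul_of_inner_eq hh hBm hB
  calc volume (Ioc (0 : ℝ) 1 • B)
      = ∫⁻ s, volume ((fun x => T (WithLp.toLp 2 (x, s))) ⁻¹' (Ioc (0 : ℝ) 1 • B)) := by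
        rw [← hcoord.measure_preimage hcone.nullMeasurableSet, Measure.volume_eq_prod,
          Measure.prod_apply_symm (hcoord.measurable hcone)]
        rfl
    _ = ∫⁻ s in Ioc 0 h, ENNReal.ofReal ((s / h) ^ k) * μHE[k] B := by
        simp_rw [volume_slice_Ioc_smul hT hh hB]
        rw [lintegral_indicator measurableSet_Ioc]
    _ = ENNReal.ofReal (h / (k + 1)) * μHE[k] B := by
        rw [lintegral_mul_const _ (by fun_prop), lintegral_Ioc_ofReal_div_pow hh]

end FlatCone

end EuclideanHausdorff

section ConeMeasure

variable {E : Type*} [NormedAddCommGroup E] [InnerProductSpace ℝ E] {H : sphere (0 : E) 1 → ℝ}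
  {v₀ : sphere (0 : E) 1} {A : Set E}

/-- The map replacing the `v₀`-coordinate of `z` by `H v₀` times its Wulff gauge. It flattens the
boundary of the Wulff shape into the hyperplane `⟨·, v₀⟩ = H v₀` and is close to an isometry where
the normals are close to `v₀`. -/
def flatten (H : sphere (0 : E) 1 → ℝ) (v₀ : sphere (0 : E) 1) (z : E) : E :=
  z + (H v₀ * wulffGauge H z - inner ℝ z (v₀ : E)) • (v₀ : E)

/-- The distance of `v / H v`, rescaled by `H v₀`, from `v₀`. -/
def normalDeviation (H : sphere (0 : E) 1 → ℝ) (v₀ v : sphere (0 : E) 1) : ℝ :=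
  ‖(H v₀ / H v) • (v : E) - v₀‖

/-- The boundary points of the Wulff shape with exactly one normal direction. -/
def wulffRegularBoundary (H : sphere (0 : E) 1 → ℝ) : Set E :=
  {x | wulffGauge H x = 1 ∧ x ∈ regularDirs H}

theorem flatten_smul {t : ℝ} (ht : 0 ≤ t) (z : E) :
    flatten H v₀ (t • z) = t • flatten H v₀ z := by
  simp only [flatten, wulffGauge_smul ht, real_inner_smul_left]
  module

theorem inner_flatten (z : E) : inner ℝ (flatten H v₀ z) (v₀ : E) = H v₀ * wulffGauge H z := by
  simp [flatten, inner_add_left, real_inner_smul_left]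

theorem image_flatten_Ioc_smul :
    flatten H v₀ '' (Ioc (0 : ℝ) 1 • A) = Ioc (0 : ℝ) 1 • flatten H v₀ '' A := by
  ext y
  constructor
  · rintro ⟨_, ⟨t, ht, a, ha, rfl⟩, rfl⟩
    exact ⟨t, ht, _, mem_image_of_mem _ ha, (flatten_smul ht.1.le a).symm⟩
  · rintro ⟨t, ht, _, ⟨a, ha, rfl⟩, rfl⟩
    exact ⟨t • a, ⟨t, ht, a, ha, rfl⟩, flatten_smul ht.1.le a⟩

theorem subset_Ioc_smul : A ⊆ Ioc (0 : ℝ) 1 • A := fun a ha =>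
  ⟨1, right_mem_Ioc.2 zero_lt_one, a, ha, one_smul ℝ a⟩

variable [FiniteDimensional ℝ E]

theorem inv_wulffGauge_smul_mem_wulffRegularBoundary (hH : Continuous H) (hpos : ∀ v, 0 < H v)
    {u : sphere (0 : E) 1} (hu : (u : E) ∈ regularDirs H) :
    (wulffGauge H (u : E))⁻¹ • (u : E) ∈ wulffRegularBoundary H := by
  have hgu := wulffGauge_coe_pos hH hpos u
  refine ⟨?_, (smul_mem_regularDirs_iff (inv_pos.2 hgu)).2 hu⟩
  rw [wulffGauge_smul (inv_nonneg.2 hgu.le), inv_mul_cancel₀ hgu.ne']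

theorem IsNormalDir.mul_wulffGauge_sub_sub_inner_le (hH : Continuous H) (hpos : ∀ v, 0 < H v)
    {z : E} {v : sphere (0 : E) 1} (hv : IsNormalDir H z v) (w : E) :
    H v₀ * (wulffGauge H z - wulffGauge H w) - inner ℝ (z - w) (v₀ : E) ≤
      normalDeviation H v₀ v * ‖z - w‖ := by
  have hsub := mul_le_mul_of_nonneg_left (hv.subgradient hH hpos w) (hpos v₀).le
  rw [← real_inner_smul_right, smul_smul, ← div_eq_mul_inv] at hsub
  have hcs := real_inner_le_norm (z - w) ((H v₀ / H v) • (v : E) - v₀)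
  rw [inner_sub_right, mul_comm] at hcs
  rw [normalDeviation]
  linarith

variable [Nontrivial E]

theorem norm_flatten_sub_flatten_sub_le (hH : Continuous H) (hpos : ∀ v, 0 < H v) {ε : ℝ} {z w : E}
    (hz : normalDeviation H v₀ (wulffNormal H z) ≤ ε)
    (hw : normalDeviation H v₀ (wulffNormal H w) ≤ ε) :
    ‖(flatten H v₀ z - flatten H v₀ w) - (z - w)‖ ≤ ε * ‖z - w‖ := by
  have heq : (flatten H v₀ z - flatten H v₀ w) - (z - w) =
      (H v₀ * (wulffGauge H z - wulffGauge H w) - inner ℝ (z - w) (v₀ : E)) • (v₀ : E) := by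
    simp only [flatten, inner_sub_left]
    module
  have hupper := (isNormalDir_wulffNormal hH hpos z).mul_wulffGauge_sub_sub_inner_le
    (v₀ := v₀) hH hpos w
  have hlower := (isNormalDir_wulffNormal hH hpos w).mul_wulffGauge_sub_sub_inner_le
    (v₀ := v₀) hH hpos z
  rw [norm_sub_rev, ← neg_sub z w, inner_neg_left] at hlower
  rw [heq, norm_smul, norm_eq_of_mem_sphere, mul_one, Real.norm_eq_abs, abs_le]
  constructor <;> nlinarith [norm_nonneg (z - w)]

theorem normalDeviation_wulffNormal_Ioc_smul_le (hH : Continuous H) (hpos : ∀ v, 0 < H v) {ε : ℝ}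
    (hA : A ⊆ regularDirs H) (hε : ∀ a ∈ A, normalDeviation H v₀ (wulffNormal H a) ≤ ε) {z : E}
    (hz : z ∈ Ioc (0 : ℝ) 1 • A) : normalDeviation H v₀ (wulffNormal H z) ≤ ε := by
  obtain ⟨t, ht, a, ha, rfl⟩ := hz
  change normalDeviation H v₀ (wulffNormal H (t • a)) ≤ ε
  rw [wulffNormal_smul hH hpos (hA ha) ht.1]
  exact hε a ha

theorem continuous_flatten (hH : Continuous H) (hpos : ∀ v, 0 < H v) :
    Continuous (flatten H v₀) := by
  have := continuous_wulffGauge hH hpos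
  unfold flatten
  fun_prop

theorem eventually_normalDeviation_le (hH : Continuous H) (hpos : ∀ v, 0 < H v) {ε : ℝ}
    (hε : 0 < ε) {x₀ : E} (hx₀ : x₀ ∈ regularDirs H) :
    ∀ᶠ x in 𝓝 x₀, normalDeviation H (wulffNormal H x₀) (wulffNormal H x) ≤ ε := by
  have hcont : Continuous (normalDeviation H (wulffNormal H x₀)) := by
    have hdiv : Continuous fun v => H (wulffNormal H x₀) / H v :=
      continuous_const.div hH fun v => (hpos v).ne'
    exact ((hdiv.smul continuous_subtype_val).sub continuous_const).norm
  refine ((hcont.continuousAt.comp (continuousAt_wulffNormal hH hpos hx₀)).eventually_lt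
    continuousAt_const ?_).mono fun _ => le_of_lt
  simp [normalDeviation, (hpos (wulffNormal H x₀)).ne', hε]

variable [MeasurableSpace E] [BorelSpace E] {k : ℕ}

theorem measurableSet_wulffRegularBoundary (hH : Continuous H) (hpos : ∀ v, 0 < H v) :
    MeasurableSet (wulffRegularBoundary H) :=
  ((continuous_wulffGauge hH hpos).measurable (measurableSet_singleton 1)).inter
    (measurableSet_regularDirs hH hpos)

theorem volume_Ioc_smul_flatten_image (hE : Module.finrank ℝ E = k + 1) (hH : Continuous H)
    (hpos : ∀ v, 0 < H v) (hAm : MeasurableSet A) (hA : A ⊆ wulffRegularBoundary H)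
    (hinj : InjOn (flatten H v₀) A) :
    volume (flatten H v₀ '' (Ioc (0 : ℝ) 1 • A)) =
      ENNReal.ofReal (H v₀ / (k + 1)) * μHE[k] (flatten H v₀ '' A) := by
  rw [image_flatten_Ioc_smul]
  refine volume_Ioc_smul_of_inner_eq (v := v₀) hE (hpos v₀)
    (hAm.image_of_continuousOn_injOn (continuous_flatten hH hpos).continuousOn hinj) ?_
  rintro _ ⟨a, ha, rfl⟩
  rw [inner_flatten, (hA ha).1, mul_one]

theorem volume_Ioc_smul_comparison (hE : Module.finrank ℝ E = k + 1) (hH : Continuous H)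
    (hpos : ∀ v, 0 < H v) {ε : ℝ} {K : ℝ≥0} (hεK : 1 + ε ≤ K) (hKε : 1 ≤ K * (1 - ε))
    (hAm : MeasurableSet A) (hA : A ⊆ wulffRegularBoundary H)
    (hdev : ∀ a ∈ A, normalDeviation H v₀ (wulffNormal H a) ≤ ε) :
    volume (Ioc (0 : ℝ) 1 • A) ≤
        (K : ℝ≥0∞) ^ (2 * k + 1) * (ENNReal.ofReal (H v₀ / (k + 1)) * μHE[k] A) ∧
      ENNReal.ofReal (H v₀ / (k + 1)) * μHE[k] A ≤
        (K : ℝ≥0∞) ^ (2 * k + 1) * volume (Ioc (0 : ℝ) 1 • A) := by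
  set C := Ioc (0 : ℝ) 1 • A
  set c := ENNReal.ofReal (H v₀ / (k + 1))
  have hclose : ∀ z ∈ C, ∀ w ∈ C,
      ‖(flatten H v₀ z - flatten H v₀ w) - (z - w)‖ ≤ ε * ‖z - w‖ := fun z hz w hw =>
    norm_flatten_sub_flatten_sub_le hH hpos
      (normalDeviation_wulffNormal_Ioc_smul_le hH hpos (fun a ha => (hA ha).2) hdev hz)
      (normalDeviation_wulffNormal_Ioc_smul_le hH hpos (fun a ha => (hA ha).2) hdev hw)
  have hlip := lipschitzOnWith_of_norm_sub_sub_le hεK hclose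
  have hanti := antilipschitzWith_domRestrict_of_norm_sub_sub_le hKε hclose
  have hantiA := antilipschitzWith_domRestrict_of_norm_sub_sub_le hKε
    fun z hz w hw => hclose z (subset_Ioc_smul hz) w (subset_Ioc_smul hw)
  have hflat := volume_Ioc_smul_flatten_image (v₀ := v₀) hE hH hpos hAm hA
    (injOn_iff_injective.2 hantiA.injective)
  have hvol : (volume : Measure E) = μHE[k + 1] := by
    rw [← hE, InnerProductSpace.euclideanHausdorffMeasure_eq_volume]
  constructor
  · calc volume C ≤ (K : ℝ≥0∞) ^ (k + 1) * volume (flatten H v₀ '' C) := by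
          rw [hvol]
          exact euclideanHausdorffMeasure_le_image hanti (k + 1)
      _ = (K : ℝ≥0∞) ^ (k + 1) * (c * μHE[k] (flatten H v₀ '' A)) := by rw [hflat]
      _ ≤ (K : ℝ≥0∞) ^ (k + 1) * (c * ((K : ℝ≥0∞) ^ k * μHE[k] A)) := by
          gcongr
          exact euclideanHausdorffMeasure_image_le (hlip.mono subset_Ioc_smul) k
      _ = (K : ℝ≥0∞) ^ (2 * k + 1) * (c * μHE[k] A) := by ring
  · calc c * μHE[k] A ≤ c * ((K : ℝ≥0∞) ^ k * μHE[k] (flatten H v₀ '' A)) := by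
          gcongr
          exact euclideanHausdorffMeasure_le_image hantiA k
      _ = (K : ℝ≥0∞) ^ k * volume (flatten H v₀ '' C) := by rw [hflat]; ring
      _ ≤ (K : ℝ≥0∞) ^ k * ((K : ℝ≥0∞) ^ (k + 1) * volume C) := by
          gcongr
          rw [hvol]
          exact euclideanHausdorffMeasure_image_le hlip (k + 1)
      _ = (K : ℝ≥0∞) ^ (2 * k + 1) * volume C := by ring

theorem setLIntegral_comparison_const {X : Type*} [MeasurableSpace X] {μ : Measure X} {S : Set X}
    (hS : MeasurableSet S) {f : X → ℝ≥0∞} {c : ℝ≥0∞} {K : ℝ≥0} (hf : ∀ x ∈ S, f x ≤ K * c)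
    (hc : ∀ x ∈ S, c ≤ K * f x) :
    ∫⁻ x in S, f x ∂μ ≤ K * (c * μ S) ∧ c * μ S ≤ K * ∫⁻ x in S, f x ∂μ := by
  rw [← mul_assoc, ← setLIntegral_const, ← setLIntegral_const,
    ← lintegral_const_mul' _ _ ENNReal.coe_ne_top]
  exact ⟨setLIntegral_mono' hS hf, setLIntegral_mono' hS hc⟩

theorem exists_nhds_volume_Ioc_smul_comparison (hE : Module.finrank ℝ E = k + 1)
    (hH : Continuous H) (hpos : ∀ v, 0 < H v) {x₀ : E} (hx₀ : x₀ ∈ regularDirs H) {K : ℝ≥0}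
    (hK : 1 < K) :
    ∃ V ∈ 𝓝 x₀, ∀ A ⊆ wulffRegularBoundary H ∩ V, MeasurableSet A →
      volume (Ioc (0 : ℝ) 1 • A) ≤ (K : ℝ≥0∞) ^ (2 * k + 2) *
          ∫⁻ x in A, ENNReal.ofReal (H (wulffNormal H x) / (k + 1)) ∂μHE[k] ∧
        ∫⁻ x in A, ENNReal.ofReal (H (wulffNormal H x) / (k + 1)) ∂μHE[k] ≤
          (K : ℝ≥0∞) ^ (2 * k + 2) * volume (Ioc (0 : ℝ) 1 • A) := by
  obtain ⟨ε, hε, hεK, hKε⟩ := exists_pos_one_add_le_and_one_le_mul_one_sub hK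
  set φ : E → ℝ≥0∞ := fun x => ENNReal.ofReal (H (wulffNormal H x) / (k + 1))
  have hφ : ContinuousAt φ x₀ := ENNReal.continuous_ofReal.continuousAt.comp
    ((hH.continuousAt.comp (continuousAt_wulffNormal hH hpos hx₀)).div_const _)
  have hφ₀ : φ x₀ < K * φ x₀ := by
    have hK' : (1 : ℝ) < K := by exact_mod_cast hK
    have hx₀' : 0 < H (wulffNormal H x₀) / (k + 1) := by have := hpos (wulffNormal H x₀); positivity
    rw [← ENNReal.ofReal_coe_nnreal, ← ENNReal.ofReal_mul K.coe_nonneg]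
    exact (ENNReal.ofReal_lt_ofReal_iff (by positivity)).2 (lt_mul_of_one_lt_left hx₀' hK')
  have hupper := hφ.eventually_lt continuousAt_const hφ₀
  have hlower := continuousAt_const.eventually_lt
    (ENNReal.Tendsto.const_mul hφ (Or.inr ENNReal.coe_ne_top)) hφ₀
  refine ⟨_, ((eventually_normalDeviation_le hH hpos hε hx₀).and (hupper.and hlower)),
    fun A hA hAm => ?_⟩
  obtain ⟨hvol, hsurf⟩ := volume_Ioc_smul_comparison hE hH hpos hεK hKε hAm
    (hA.trans inter_subset_left) fun a ha => (hA ha).2.1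
  obtain ⟨hint, hconst⟩ := setLIntegral_comparison_const (μ := μHE[k]) hAm
    (fun a ha => (hA ha).2.2.1.le) (fun a ha => (hA ha).2.2.2.le)
  constructor
  · calc volume (Ioc (0 : ℝ) 1 • A) ≤ _ := hvol
      _ ≤ (K : ℝ≥0∞) ^ (2 * k + 1) * (K * ∫⁻ x in A, φ x ∂μHE[k]) := by gcongr
      _ = _ := by ring
  · calc ∫⁻ x in A, φ x ∂μHE[k] ≤ _ := hint
      _ ≤ K * ((K : ℝ≥0∞) ^ (2 * k + 1) * volume (Ioc (0 : ℝ) 1 • A)) := by gcongr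
      _ = _ := by ring

/-- The image of Lebesgue measure on the Wulff shape under radial projection to its boundary. -/
def coneMeasure (H : sphere (0 : E) 1 → ℝ) : Measure E :=
  (volume.restrict (wulffShape H)).map fun z => (wulffGauge H z)⁻¹ • z

theorem measurable_inv_wulffGauge_smul (hH : Continuous H) (hpos : ∀ v, 0 < H v) :
    Measurable fun z : E => (wulffGauge H z)⁻¹ • z :=
  (continuous_wulffGauge hH hpos).measurable.inv.smul measurable_id

theorem coneMeasure_apply (hH : Continuous H) (hpos : ∀ v, 0 < H v) (hAm : MeasurableSet A)
    (hA : A ⊆ wulffRegularBoundary H) : coneMeasure H A = volume (Ioc (0 : ℝ) 1 • A) := by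
  have hmeas := measurable_inv_wulffGauge_smul hH hpos
  rw [coneMeasure, Measure.map_apply hmeas hAm, Measure.restrict_apply (hmeas hAm)]
  congr 1
  ext z
  constructor
  · rintro ⟨hzA, hz⟩
    have hz0 : z ≠ 0 := by
      rintro rfl
      exact (hA hzA).2.1 (smul_zero _)
    have hgz := wulffGauge_pos hH hpos hz0
    exact ⟨wulffGauge H z, ⟨hgz, (mem_wulffShape_iff hH hpos).1 hz⟩, _, hzA,
      smul_inv_smul₀ hgz.ne' z⟩
  · rintro ⟨t, ⟨ht0, ht1⟩, a, ha, rfl⟩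
    have hgz : wulffGauge H (t • a) = t := by
      rw [wulffGauge_smul ht0.le, (hA ha).1, mul_one]
    refine ⟨?_, (mem_wulffShape_iff hH hpos).2 (hgz.trans_le ht1)⟩
    change (wulffGauge H (t • a))⁻¹ • t • a ∈ A
    rwa [hgz, inv_smul_smul₀ ht0.ne']

theorem coneMeasure_eq_setLIntegral (hE : Module.finrank ℝ E = k + 1) (hH : Continuous H)
    (hpos : ∀ v, 0 < H v) (hAm : MeasurableSet A) (hA : A ⊆ wulffRegularBoundary H) :
    coneMeasure H A =
      ∫⁻ x in A, ENNReal.ofReal (H (wulffNormal H x) / (k + 1)) ∂μHE[k] := by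
  set φ : E → ℝ≥0∞ := fun x => ENNReal.ofReal (H (wulffNormal H x) / (k + 1))
  rw [← withDensity_apply _ hAm]
  refine le_antisymm (ennreal_le_of_forall_le_pow_mul (2 * k + 2) fun K hK => ?_)
    (ennreal_le_of_forall_le_pow_mul (2 * k + 2) fun K hK => ?_)
  · refine measure_le_of_locally_le
      (ν := (K : ℝ≥0∞) ^ (2 * k + 2) • μHE[k].withDensity φ) (fun x hx => ?_) hA hAm
    obtain ⟨V, hV, hcomp⟩ := exists_nhds_volume_Ioc_smul_comparison hE hH hpos hx.2 hK
    refine ⟨V, hV, fun B hB hBm => ?_⟩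
    rw [coneMeasure_apply hH hpos hBm (hB.trans inter_subset_left), Measure.smul_apply,
      withDensity_apply _ hBm]
    exact (hcomp B hB hBm).1
  · refine measure_le_of_locally_le (ν := (K : ℝ≥0∞) ^ (2 * k + 2) • coneMeasure H)
      (fun x hx => ?_) hA hAm
    obtain ⟨V, hV, hcomp⟩ := exists_nhds_volume_Ioc_smul_comparison hE hH hpos hx.2 hK
    refine ⟨V, hV, fun B hB hBm => ?_⟩
    rw [Measure.smul_apply, coneMeasure_apply hH hpos hBm (hB.trans inter_subset_left),
      withDensity_apply _ hBm]
    exact (hcomp B hB hBm).2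

theorem restrict_coneMeasure_eq_withDensity (hE : Module.finrank ℝ E = k + 1) (hH : Continuous H)
    (hpos : ∀ v, 0 < H v) :
    (coneMeasure H).restrict (wulffRegularBoundary H) =
      (μHE[k].restrict (wulffRegularBoundary H)).withDensity fun x =>
        ENNReal.ofReal (H (wulffNormal H x) / (k + 1)) := by
  have hR := measurableSet_wulffRegularBoundary hH hpos
  refine Measure.ext fun A hAm => ?_
  rw [withDensity_apply _ hAm, Measure.restrict_restrict hAm, Measure.restrict_apply hAm,
    coneMeasure_eq_setLIntegral hE hH hpos (hAm.inter hR) inter_subset_right]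

end ConeMeasure

section Polar

variable {E : Type*} [NormedAddCommGroup E] [InnerProductSpace ℝ E] [FiniteDimensional ℝ E]
  [MeasurableSpace E] [BorelSpace E] [Nontrivial E] {H : sphere (0 : E) 1 → ℝ}

theorem lintegral_eq_lintegral_toSphere {f : E → ℝ≥0∞} (hf : Measurable f) :
    ∫⁻ z, f z = ∫⁻ u : sphere (0 : E) 1, (∫⁻ r in Ioi (0 : ℝ),
      ENNReal.ofReal (r ^ (Module.finrank ℝ E - 1)) * f (r • (u : E)))
        ∂(volume : Measure E).toSphere := by
  have hpolar := (volume : Measure E).measurePreserving_homeomorphUnitSphereProd.symm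
    (homeomorphUnitSphereProd E).toMeasurableEquiv
  calc ∫⁻ z, f z = ∫⁻ z in ({0}ᶜ : Set E), f z := by rw [restrict_compl_singleton]
    _ = ∫⁻ z : ({0}ᶜ : Set E), f z ∂((volume : Measure E).comap (↑)) :=
        (lintegral_subtype_comap (measurableSet_singleton _).compl f).symm
    _ = ∫⁻ x : sphere (0 : E) 1 × Ioi (0 : ℝ), f ((x.2 : ℝ) • (x.1 : E))
          ∂((volume : Measure E).toSphere.prod (.volumeIoiPow (Module.finrank ℝ E - 1))) := by
        rw [← hpolar.map_eq, lintegral_map_equiv]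
        rfl
    _ = ∫⁻ u : sphere (0 : E) 1, ∫⁻ r : Ioi (0 : ℝ), f ((r : ℝ) • (u : E))
          ∂(.volumeIoiPow (Module.finrank ℝ E - 1)) ∂(volume : Measure E).toSphere :=
        lintegral_prod _ (by fun_prop)
    _ = _ := by
        refine lintegral_congr fun u => ?_
        rw [Measure.volumeIoiPow, lintegral_withDensity_eq_lintegral_mul _ (by fun_prop)
          (by fun_prop), ← lintegral_subtype_comap measurableSet_Ioi]
        rfl

theorem setLIntegral_wulffShape (hH : Continuous H) (hpos : ∀ v, 0 < H v) {f : E → ℝ≥0∞}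
    (hf : Measurable f) :
    ∫⁻ z in wulffShape H, f z = ∫⁻ u : sphere (0 : E) 1,
      (∫⁻ r in Ioc 0 (wulffGauge H (u : E))⁻¹,
        ENNReal.ofReal (r ^ (Module.finrank ℝ E - 1)) * f (r • (u : E)))
          ∂(volume : Measure E).toSphere := by
  have hS : MeasurableSet (wulffShape H) := isClosed_wulffShape.measurableSet
  rw [← lintegral_indicator hS, lintegral_eq_lintegral_toSphere (hf.indicator hS)]
  refine lintegral_congr fun u => ?_
  have hu := wulffGauge_coe_pos hH hpos u
  rw [← lintegral_indicator measurableSet_Ioc, ← lintegral_indicator measurableSet_Ioi]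
  congr 1 with r
  by_cases hr : r ∈ Ioi (0 : ℝ)
  · have hiff : r • (u : E) ∈ wulffShape H ↔ r ∈ Ioc 0 (wulffGauge H (u : E))⁻¹ := by
      rw [mem_wulffShape_iff hH hpos, wulffGauge_smul (le_of_lt hr), ← le_div_iff₀ hu, one_div]
      exact ⟨fun h => ⟨hr, h⟩, And.right⟩
    by_cases hr' : r ∈ Ioc 0 (wulffGauge H (u : E))⁻¹
    · rw [indicator_of_mem hr, indicator_of_mem hr', indicator_of_mem (hiff.2 hr')]
    · rw [indicator_of_mem hr, indicator_of_notMem hr', indicator_of_notMem (mt hiff.1 hr'),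
        mul_zero]
  · rw [indicator_of_notMem hr, indicator_of_notMem fun h => hr h.1]

theorem lintegral_Ioc_ofReal_pow {a : ℝ} (ha : 0 ≤ a) (k : ℕ) :
    ∫⁻ r in Ioc 0 a, ENNReal.ofReal (r ^ k) = ENNReal.ofReal (a ^ (k + 1) / (k + 1)) := by
  rw [← ofReal_integral_eq_lintegral_ofReal, ← intervalIntegral.integral_of_le ha, integral_pow]
  · simp
  · exact (Continuous.integrableOn_Icc (by fun_prop)).mono_set Ioc_subset_Icc_self
  · filter_upwards [ae_restrict_mem measurableSet_Ioc] with y hy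
    exact pow_nonneg hy.1.le _

theorem lintegral_coneMeasure {k : ℕ} (hE : Module.finrank ℝ E = k + 1)
    (hH : Continuous H) (hpos : ∀ v, 0 < H v) {f : E → ℝ≥0∞} (hf : Measurable f) :
    ∫⁻ x, f x ∂coneMeasure H = ∫⁻ u : sphere (0 : E) 1,
      ENNReal.ofReal ((wulffGauge H (u : E))⁻¹ ^ (k + 1) / (k + 1)) *
        f ((wulffGauge H (u : E))⁻¹ • (u : E)) ∂(volume : Measure E).toSphere := by
  have hproj := measurable_inv_wulffGauge_smul hH hpos
  rw [coneMeasure, lintegral_map hf hproj,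
    setLIntegral_wulffShape hH hpos (f := fun z => f ((wulffGauge H z)⁻¹ • z)) (hf.comp hproj), hE]
  refine lintegral_congr fun u => ?_
  have hu := wulffGauge_coe_pos hH hpos u
  rw [← lintegral_Ioc_ofReal_pow (inv_nonneg.2 hu.le), ← lintegral_mul_const _ (by fun_prop)]
  refine setLIntegral_congr_fun measurableSet_Ioc fun r hr => ?_
  have hproj_smul : (wulffGauge H (r • (u : E)))⁻¹ • r • (u : E) =
      (wulffGauge H (u : E))⁻¹ • (u : E) := by
    rw [wulffGauge_smul hr.1.le, smul_smul]
    congr 1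
    field_simp [hr.1.ne']
  simp only [hproj_smul, Nat.add_sub_cancel]

theorem ae_toSphere_mem_regularDirs (hH : Continuous H) (hpos : ∀ v, 0 < H v) :
    ∀ᵐ u : sphere (0 : E) 1 ∂(volume : Measure E).toSphere, (u : E) ∈ regularDirs H := by
  have hm : MeasurableSet {u : sphere (0 : E) 1 | (u : E) ∉ regularDirs H} :=
    (measurable_subtype_coe (measurableSet_regularDirs hH hpos)).compl
  have hnull : volume (regularDirs H)ᶜ = 0 := ae_iff.1 (ae_mem_regularDirs hH hpos volume)
  rw [ae_iff, Measure.toSphere_apply' _ hm, measure_mono_null ?_ hnull, mul_zero]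
  rintro _ ⟨r, hr, _, ⟨u, hu, rfl⟩, rfl⟩
  exact fun hmem => hu ((smul_mem_regularDirs_iff hr.1).1 hmem)

theorem setLIntegral_wulffRegularBoundary {k : ℕ} (hE : Module.finrank ℝ E = k + 1)
    (hH : Continuous H) (hpos : ∀ v, 0 < H v) {f : E → ℝ≥0∞}
    (hf : Measurable ((wulffRegularBoundary H).indicator f)) :
    ∫⁻ x in wulffRegularBoundary H, ENNReal.ofReal (H (wulffNormal H x)) * f x ∂μHE[k] =
      ∫⁻ u : sphere (0 : E) 1, ENNReal.ofReal ((wulffGauge H (u : E))⁻¹ ^ (k + 1)) *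
        f ((wulffGauge H (u : E))⁻¹ • (u : E)) ∂(volume : Measure E).toSphere := by
  set R := wulffRegularBoundary H
  have hR : MeasurableSet R := measurableSet_wulffRegularBoundary hH hpos
  set c := ENNReal.ofReal (k + 1)
  have hc : ∀ t, ENNReal.ofReal t = c * ENNReal.ofReal (t / (k + 1)) := fun t => by
    rw [← ENNReal.ofReal_mul (by positivity)]
    congr 1
    field_simp
  have hN : AEMeasurable (wulffNormal H) (μHE[k].restrict R) :=
    ((continuousOn_wulffNormal hH hpos).mono fun _ hx => hx.2).aemeasurable hR
  calc ∫⁻ x in R, ENNReal.ofReal (H (wulffNormal H x)) * f x ∂μHE[k]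
      = c * ∫⁻ x in R, ENNReal.ofReal (H (wulffNormal H x) / (k + 1)) * f x ∂μHE[k] := by
        rw [← lintegral_const_mul' _ _ ENNReal.ofReal_ne_top]
        refine lintegral_congr fun x => ?_
        rw [hc (H (wulffNormal H x)), mul_assoc]
    _ = c * ∫⁻ x in R, f x ∂coneMeasure H := by
        rw [restrict_coneMeasure_eq_withDensity hE hH hpos,
          lintegral_withDensity_eq_lintegral_mul₀]
        · rfl
        · exact ((hH.measurable.comp_aemeasurable hN).div_const _).ennreal_ofReal
        · exact (aemeasurable_indicator_iff hR).1 hf.aemeasurable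
    _ = c * ∫⁻ u : sphere (0 : E) 1,
          ENNReal.ofReal ((wulffGauge H (u : E))⁻¹ ^ (k + 1) / (k + 1)) *
            R.indicator f ((wulffGauge H (u : E))⁻¹ • (u : E)) ∂(volume : Measure E).toSphere := by
        rw [← lintegral_indicator hR, lintegral_coneMeasure hE hH hpos hf]
    _ = _ := by
        rw [← lintegral_const_mul' _ _ ENNReal.ofReal_ne_top]
        refine lintegral_congr_ae ?_
        filter_upwards [ae_toSphere_mem_regularDirs hH hpos] with u hu
        rw [indicator_of_mem (inv_wulffGauge_smul_mem_wulffRegularBoundary hH hpos hu), ← mul_assoc,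
          ← hc]

end Polar

section GaussianVolume

/-- The measure `|z| ^ (q - dim E) * exp (-|z|² / 2) dz`, whose value on a convex body is its
`q`-th Gaussian dual quermassintegral, up to normalization. -/
def gaussDualMeasure (E : Type*) [NormedAddCommGroup E] [InnerProductSpace ℝ E]
    [FiniteDimensional ℝ E] [MeasurableSpace E] [BorelSpace E] (q : ℝ) : Measure E :=
  volume.withDensity fun z =>
    ENNReal.ofReal (‖z‖ ^ (q - Module.finrank ℝ E) * Real.exp (-(‖z‖ ^ 2) / 2))

/-- The density of `gaussDualMeasure` with respect to `dr` along a ray. -/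
def radialDensity (q r : ℝ) : ℝ := r ^ (q - 1) * Real.exp (-(r ^ 2) / 2)

/-- The primitive of `radialDensity` vanishing at the origin. -/
def radialPrimitive (q r : ℝ) : ℝ := ∫ s in (0 : ℝ)..r, radialDensity q s

/-- Minus the derivative of `radialPrimitive q (exp (-τ))` in `τ`, in terms of `r = exp (-τ)`: the
weight by which a logarithmic perturbation of the radial function changes the Gaussian volume. -/
def radialWeight (q r : ℝ) : ℝ := r ^ q * Real.exp (-(r ^ 2) / 2)

variable {q r : ℝ}

theorem measurable_radialDensity : Measurable (radialDensity q) := by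
  unfold radialDensity
  fun_prop

theorem radialDensity_nonneg (hr : 0 ≤ r) : 0 ≤ radialDensity q r := by
  unfold radialDensity
  positivity

theorem radialWeight_pos (hr : 0 < r) : 0 < radialWeight q r := by
  unfold radialWeight
  positivity

theorem radialWeight_le_rpow (hr : 0 ≤ r) : radialWeight q r ≤ r ^ q :=
  mul_le_of_le_one_right (by positivity) (Real.exp_le_one_iff.2 (by linarith [sq_nonneg r]))

theorem continuous_radialWeight (hq : 0 < q) : Continuous (radialWeight q) :=
  (Real.continuous_rpow_const hq.le).mul (by fun_prop)

theorem intervalIntegrable_radialDensity (hq : 0 < q) (a b : ℝ) :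
    IntervalIntegrable (radialDensity q) volume a b :=
  (intervalIntegral.intervalIntegrable_rpow' (by linarith)).mul_continuousOn (by fun_prop)

theorem continuous_radialPrimitive (hq : 0 < q) : Continuous (radialPrimitive q) :=
  intervalIntegral.continuous_primitive (intervalIntegrable_radialDensity hq) 0

theorem radialPrimitive_nonneg (hr : 0 ≤ r) : 0 ≤ radialPrimitive q r :=
  intervalIntegral.integral_nonneg hr fun _ hs => radialDensity_nonneg hs.1

theorem hasDerivAt_radialPrimitive (hq : 0 < q) (hr : 0 < r) :
    HasDerivAt (radialPrimitive q) (radialDensity q r) r :=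
  intervalIntegral.integral_hasDerivAt_right (intervalIntegrable_radialDensity hq 0 r)
    measurable_radialDensity.stronglyMeasurable.stronglyMeasurableAtFilter
    ((Real.continuousAt_rpow_const _ _ (Or.inl hr.ne')).mul (by fun_prop))

theorem hasDerivAt_radialPrimitive_exp_neg (hq : 0 < q) (τ : ℝ) :
    HasDerivAt (fun τ => radialPrimitive q (Real.exp (-τ)))
      (-radialWeight q (Real.exp (-τ))) τ := by
  refine ((hasDerivAt_radialPrimitive hq (Real.exp_pos (-τ))).comp τ
    ((Real.hasDerivAt_exp (-τ)).comp τ (hasDerivAt_neg τ))).congr_deriv ?_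
  rw [radialWeight, radialDensity, Real.rpow_sub_one (Real.exp_pos _).ne']
  field_simp

theorem abs_radialPrimitive_exp_neg_sub_le (hq : 0 < q) {T s t : ℝ} (hs : -T ≤ s) (ht : -T ≤ t) :
    |radialPrimitive q (Real.exp (-s)) - radialPrimitive q (Real.exp (-t))| ≤
      Real.exp T ^ q * |s - t| := by
  refine Convex.norm_image_sub_le_of_norm_hasDerivWithin_le (s := Ici (-T))
    (f := fun τ => radialPrimitive q (Real.exp (-τ)))
    (fun τ _ => (hasDerivAt_radialPrimitive_exp_neg hq τ).hasDerivWithinAt) (fun τ hτ => ?_)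
    (convex_Ici (-T)) ht hs
  rw [norm_neg, Real.norm_of_nonneg (radialWeight_pos (Real.exp_pos _)).le]
  refine (radialWeight_le_rpow (Real.exp_pos _).le).trans ?_
  gcongr
  exact neg_le.1 hτ

theorem lintegral_Ioc_radialDensity (hq : 0 < q) (hr : 0 ≤ r) :
    ∫⁻ s in Ioc 0 r, ENNReal.ofReal (radialDensity q s) = ENNReal.ofReal (radialPrimitive q r) := by
  rw [radialPrimitive, intervalIntegral.integral_of_le hr, ofReal_integral_eq_lintegral_ofReal]
  · exact (intervalIntegrable_radialDensity hq 0 r).1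
  · filter_upwards [ae_restrict_mem measurableSet_Ioc] with s hs
    exact radialDensity_nonneg hs.1.le

variable {E : Type*} [NormedAddCommGroup E] [InnerProductSpace ℝ E] [FiniteDimensional ℝ E]
  [Nontrivial E]

theorem ofReal_pow_mul_gaussDualMeasure_density (hr : 0 < r) (u : sphere (0 : E) 1) :
    ENNReal.ofReal (r ^ (Module.finrank ℝ E - 1)) *
      ENNReal.ofReal (‖r • (u : E)‖ ^ (q - Module.finrank ℝ E) *
        Real.exp (-(‖r • (u : E)‖ ^ 2) / 2)) = ENNReal.ofReal (radialDensity q r) := by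
  have hdim : 1 ≤ Module.finrank ℝ E := Module.finrank_pos
  rw [← ENNReal.ofReal_mul (by positivity), norm_smul, norm_eq_of_mem_sphere, mul_one,
    Real.norm_of_nonneg hr.le, ← mul_assoc, ← Real.rpow_natCast, ← Real.rpow_add hr,
    Nat.cast_sub hdim, radialDensity]
  congr 3
  push_cast
  ring

variable [MeasurableSpace E] [BorelSpace E] {H : sphere (0 : E) 1 → ℝ}

theorem volume_absolutelyContinuous_gaussDualMeasure : volume ≪ gaussDualMeasure E q := by
  refine withDensity_absolutelyContinuous' (by fun_prop) ?_
  filter_upwards [Measure.ae_ne volume 0] with z hz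
  have := norm_pos_iff.2 hz
  positivity

theorem gaussDualMeasure_wulffShape (hq : 0 < q) (hH : Continuous H) (hpos : ∀ v, 0 < H v) :
    gaussDualMeasure E q (wulffShape H) = ENNReal.ofReal (∫ u : sphere (0 : E) 1,
      radialPrimitive q (wulffGauge H (u : E))⁻¹ ∂(volume : Measure E).toSphere) := by
  have hradius : ∀ u : sphere (0 : E) 1, 0 ≤ (wulffGauge H (u : E))⁻¹ := fun u =>
    (inv_pos.2 (wulffGauge_coe_pos hH hpos u)).le
  have hcont : Continuous fun u : sphere (0 : E) 1 =>
      radialPrimitive q (wulffGauge H (u : E))⁻¹ :=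
    (continuous_radialPrimitive hq).comp (continuous_inv_wulffGauge_coe hH hpos)
  rw [ofReal_integral_eq_lintegral_ofReal
      (hcont.integrable_of_hasCompactSupport (.of_compactSpace _))
      (Eventually.of_forall fun u => radialPrimitive_nonneg (hradius u)),
    gaussDualMeasure, withDensity_apply _ isClosed_wulffShape.measurableSet,
    setLIntegral_wulffShape hH hpos (by fun_prop)]
  refine lintegral_congr fun u => ?_
  rw [← lintegral_Ioc_radialDensity hq (hradius u)]
  exact setLIntegral_congr_fun measurableSet_Ioc fun r hr =>
    ofReal_pow_mul_gaussDualMeasure_density hr.1 u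

end GaussianVolume

section Variation

variable {E : Type*} [NormedAddCommGroup E] {H φ : sphere (0 : E) 1 → ℝ}

/-- The logarithmic variation of `H` in the direction `φ`. -/
def logVariation (H φ : sphere (0 : E) 1 → ℝ) (t : ℝ) (v : sphere (0 : E) 1) : ℝ :=
  H v * Real.exp (t * φ v)

theorem logVariation_zero : logVariation H φ 0 = H := by
  ext v
  simp [logVariation]

theorem continuous_logVariation (hH : Continuous H) (hφ : Continuous φ) (t : ℝ) :
    Continuous (logVariation H φ t) := by
  unfold logVariation
  fun_prop

theorem logVariation_pos (hpos : ∀ v, 0 < H v) (t : ℝ) (v : sphere (0 : E) 1) :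
    0 < logVariation H φ t v :=
  mul_pos (hpos v) (Real.exp_pos _)

theorem logVariation_neg (heven : ∀ v, H (-v) = H v) (hφeven : ∀ v, φ (-v) = φ v) (t : ℝ)
    (v : sphere (0 : E) 1) : logVariation H φ t (-v) = logVariation H φ t v := by
  rw [logVariation, logVariation, heven, hφeven]

theorem logVariation_div_logVariation (hpos : ∀ v, 0 < H v) (s t : ℝ) (v : sphere (0 : E) 1) :
    logVariation H φ t v / logVariation H φ s v = Real.exp ((t - s) * φ v) := by
  rw [logVariation, logVariation, mul_div_mul_left _ _ (hpos v).ne', ← Real.exp_sub, sub_mul]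

theorem logVariation_rpow (hpos : ∀ v, 0 < H v) (p t : ℝ) (v : sphere (0 : E) 1) :
    logVariation H φ t v ^ p = H v ^ p * Real.exp (t * (p * φ v)) := by
  rw [logVariation, Real.mul_rpow (hpos v).le (Real.exp_pos _).le, ← Real.exp_mul]
  ring_nf

variable [InnerProductSpace ℝ E] [FiniteDimensional ℝ E]

theorem IsNormalDir.log_wulffGauge_logVariation_add_le (hH : Continuous H) (hpos : ∀ v, 0 < H v)
    (hφ : Continuous φ) {u : E} (hu : u ≠ 0) {t : ℝ} {v : sphere (0 : E) 1}
    (hv : IsNormalDir (logVariation H φ t) u v) (s : ℝ) :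
    Real.log (wulffGauge (logVariation H φ t) u) + (t - s) * φ v ≤
      Real.log (wulffGauge (logVariation H φ s) u) := by
  have ht := wulffGauge_pos (continuous_logVariation hH hφ t) (logVariation_pos hpos t) hu
  have hle : wulffGauge (logVariation H φ t) u * Real.exp ((t - s) * φ v) ≤
      wulffGauge (logVariation H φ s) u :=
    calc wulffGauge (logVariation H φ t) u * Real.exp ((t - s) * φ v)
        = inner ℝ u (v : E) / logVariation H φ s v := by
          rw [← logVariation_div_logVariation hpos, ← mul_div_assoc, ← hv]
      _ ≤ wulffGauge (logVariation H φ s) u :=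
          inner_div_le_wulffGauge (continuous_logVariation hH hφ s) (logVariation_pos hpos s) u v
  have hlog := Real.log_le_log (by positivity) hle
  rwa [Real.log_mul ht.ne' (Real.exp_pos _).ne', Real.log_exp] at hlog

variable [Nontrivial E]

theorem abs_log_wulffGauge_logVariation_sub_le (hH : Continuous H) (hpos : ∀ v, 0 < H v)
    (hφ : Continuous φ) {C : ℝ} (hC : ∀ v, |φ v| ≤ C) {u : E} (hu : u ≠ 0) (s t : ℝ) :
    |Real.log (wulffGauge (logVariation H φ s) u) -
      Real.log (wulffGauge (logVariation H φ t) u)| ≤ C * |s - t| := by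
  have hone_sided : ∀ s t : ℝ, Real.log (wulffGauge (logVariation H φ t) u) -
      Real.log (wulffGauge (logVariation H φ s) u) ≤ C * |s - t| := by
    intro s t
    obtain ⟨v, hv⟩ := exists_isNormalDir (continuous_logVariation hH hφ t)
      (logVariation_pos hpos t) u
    have hlower := hv.log_wulffGauge_logVariation_add_le hH hpos hφ hu s
    have hslope : (s - t) * φ v ≤ C * |s - t| := by
      rw [mul_comm C]
      refine (le_abs_self _).trans ?_
      rw [abs_mul]
      gcongr
      exact hC v
    linarith
  rw [abs_sub_le_iff]
  exact ⟨abs_sub_comm s t ▸ hone_sided t s, hone_sided s t⟩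

theorem continuous_wulffGauge_logVariation (hH : Continuous H) (hpos : ∀ v, 0 < H v)
    (hφ : Continuous φ) {u : E} (hu : u ≠ 0) :
    Continuous fun t => wulffGauge (logVariation H φ t) u := by
  obtain ⟨C, hC0, hC⟩ := exists_pos_forall_ge hφ.abs
  have hlog : LipschitzWith ⟨C, hC0.le⟩ fun t => Real.log (wulffGauge (logVariation H φ t) u) :=
    .of_dist_le_mul fun s t => abs_log_wulffGauge_logVariation_sub_le hH hpos hφ hC hu s t
  refine (Real.continuous_exp.comp hlog.continuous).congr fun t => ?_
  exact Real.exp_log (wulffGauge_pos (continuous_logVariation hH hφ t) (logVariation_pos hpos t) hu)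

theorem eventually_forall_isNormalDir_logVariation_mem (hH : Continuous H) (hpos : ∀ v, 0 < H v)
    (hφ : Continuous φ) {u : E} (hu : u ∈ regularDirs H) {W : Set (sphere (0 : E) 1)}
    (hW : IsOpen W) (hmem : wulffNormal H u ∈ W) :
    ∀ᶠ t in 𝓝 (0 : ℝ), ∀ v, IsNormalDir (logVariation H φ t) u v → v ∈ W := by
  have hclosed : IsClosed {a : ℝ × sphere (0 : E) 1 |
      IsNormalDir (logVariation H φ a.1) u a.2} := by
    refine isClosed_eq (continuous_const.inner (continuous_subtype_val.comp continuous_snd))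
      (((continuous_wulffGauge_logVariation hH hpos hφ hu.1).comp continuous_fst).mul ?_)
    unfold logVariation
    fun_prop
  refine eventually_forall_mem_of_isClosed hclosed hW fun v hv => ?_
  rw [logVariation_zero] at hv
  rwa [← wulffNormal_eq hH hpos hu hv]

theorem hasDerivAt_log_wulffGauge_logVariation (hH : Continuous H) (hpos : ∀ v, 0 < H v)
    (hφ : Continuous φ) {u : E} (hu : u ∈ regularDirs H) :
    HasDerivAt (fun t => Real.log (wulffGauge (logVariation H φ t) u))
      (-φ (wulffNormal H u)) 0 := by
  rw [hasDerivAt_iff_isLittleO, Asymptotics.isLittleO_iff]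
  intro ε hε
  have hnear := eventually_forall_isNormalDir_logVariation_mem hH hpos hφ hu
    (W := {v | |φ v - φ (wulffNormal H u)| < ε}) (isOpen_lt (by fun_prop) continuous_const)
    (by simpa using hε)
  filter_upwards [hnear] with t ht
  obtain ⟨v, hv⟩ := exists_isNormalDir (continuous_logVariation hH hφ t)
    (logVariation_pos hpos t) u
  have hupper := hv.log_wulffGauge_logVariation_add_le hH hpos hφ hu.1 0
  have hnormal : IsNormalDir (logVariation H φ 0) u (wulffNormal H u) := by
    rw [logVariation_zero]
    exact isNormalDir_wulffNormal hH hpos u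
  have hlower := hnormal.log_wulffGauge_logVariation_add_le hH hpos hφ hu.1 t
  have hslope : |t * (φ v - φ (wulffNormal H u))| ≤ ε * |t| := by
    rw [abs_mul, mul_comm]
    gcongr
    exact (ht v hv).le
  simp only [sub_zero, zero_sub, smul_eq_mul, Real.norm_eq_abs] at hupper hlower ⊢
  rw [abs_le] at hslope ⊢
  constructor <;> linarith [hslope.1, hslope.2]

theorem hasDerivAt_radialPrimitive_inv_wulffGauge {q : ℝ} (hq : 0 < q) (hH : Continuous H)
    (hpos : ∀ v, 0 < H v) (hφ : Continuous φ) {u : E} (hu : u ∈ regularDirs H) :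
    HasDerivAt (fun t => radialPrimitive q (wulffGauge (logVariation H φ t) u)⁻¹)
      (radialWeight q (wulffGauge H u)⁻¹ * φ (wulffNormal H u)) 0 := by
  have hexp : ∀ t, Real.exp (-Real.log (wulffGauge (logVariation H φ t) u)) =
      (wulffGauge (logVariation H φ t) u)⁻¹ := fun t => by
    rw [Real.exp_neg, Real.exp_log
      (wulffGauge_pos (continuous_logVariation hH hφ t) (logVariation_pos hpos t) hu.1)]
  have hcomp := (hasDerivAt_radialPrimitive_exp_neg hq
    (Real.log (wulffGauge (logVariation H φ 0) u))).comp 0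
      (hasDerivAt_log_wulffGauge_logVariation hH hpos hφ hu)
  simp only [Function.comp_def, hexp, neg_mul_neg] at hcomp
  rwa [logVariation_zero] at hcomp

theorem exists_lipschitzOnWith_radialPrimitive_inv_wulffGauge {q : ℝ} (hq : 0 < q)
    (hH : Continuous H) (hpos : ∀ v, 0 < H v) (hφ : Continuous φ) :
    ∃ L : ℝ≥0, ∀ u : sphere (0 : E) 1, LipschitzOnWith L
      (fun t => radialPrimitive q (wulffGauge (logVariation H φ t) (u : E))⁻¹) (ball 0 1) := by
  obtain ⟨C, hC0, hC⟩ := exists_pos_forall_ge hφ.abs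
  obtain ⟨M, -, hM⟩ := exists_pos_forall_ge
    ((continuous_wulffGauge_coe hH hpos).log fun u => (wulffGauge_coe_pos hH hpos u).ne').abs
  have hgauge : ∀ t (u : sphere (0 : E) 1), 0 < wulffGauge (logVariation H φ t) (u : E) :=
    fun t u => wulffGauge_coe_pos (continuous_logVariation hH hφ t) (logVariation_pos hpos t) u
  have hlog_ge : ∀ t ∈ ball (0 : ℝ) 1, ∀ u : sphere (0 : E) 1,
      -(M + C) ≤ Real.log (wulffGauge (logVariation H φ t) (u : E)) := fun t ht u => by
    have hchange := abs_log_wulffGauge_logVariation_sub_le hH hpos hφ hC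
      (ne_zero_of_mem_unit_sphere u) t 0
    rw [logVariation_zero, sub_zero] at hchange
    have hCt : C * |t| ≤ C := mul_le_of_le_one_right hC0.le (mem_ball_zero_iff.1 ht).le
    linarith [(abs_le.1 hchange).1, (abs_le.1 (hM u)).1]
  refine ⟨(Real.exp (M + C) ^ q * C).toNNReal, fun u => .of_dist_le_mul fun s hs t ht => ?_⟩
  rw [Real.dist_eq, Real.dist_eq, ← Real.exp_log (hgauge s u), ← Real.exp_log (hgauge t u),
    ← Real.exp_neg, ← Real.exp_neg]
  refine (abs_radialPrimitive_exp_neg_sub_le hq (hlog_ge s hs u) (hlog_ge t ht u)).trans ?_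
  rw [Real.coe_toNNReal _ (by positivity), mul_assoc]
  gcongr
  exact abs_log_wulffGauge_logVariation_sub_le hH hpos hφ hC (ne_zero_of_mem_unit_sphere u) s t

variable [MeasurableSpace E] [BorelSpace E]

theorem aemeasurable_wulffNormal_coe (hH : Continuous H) (hpos : ∀ v, 0 < H v) :
    AEMeasurable (fun u : sphere (0 : E) 1 => wulffNormal H (u : E))
      (volume : Measure E).toSphere := by
  rw [← Measure.restrict_eq_self_of_ae_mem (ae_toSphere_mem_regularDirs hH hpos)]
  exact ((continuousOn_wulffNormal hH hpos).comp continuous_subtype_val.continuousOn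
    fun _ hu => hu).aemeasurable (measurable_subtype_coe (measurableSet_regularDirs hH hpos))

theorem hasDerivAt_integral_radialPrimitive {q : ℝ} (hq : 0 < q) (hH : Continuous H)
    (hpos : ∀ v, 0 < H v) (hφ : Continuous φ) :
    HasDerivAt (fun t => ∫ u : sphere (0 : E) 1,
        radialPrimitive q (wulffGauge (logVariation H φ t) (u : E))⁻¹
          ∂(volume : Measure E).toSphere)
      (∫ u : sphere (0 : E) 1, radialWeight q (wulffGauge H (u : E))⁻¹ *
        φ (wulffNormal H (u : E)) ∂(volume : Measure E).toSphere) 0 := by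
  have hcont : ∀ t, Continuous fun u : sphere (0 : E) 1 =>
      radialPrimitive q (wulffGauge (logVariation H φ t) (u : E))⁻¹ := fun t =>
    (continuous_radialPrimitive hq).comp
      (continuous_inv_wulffGauge_coe (continuous_logVariation hH hφ t) (logVariation_pos hpos t))
  have hweight : AEMeasurable (fun u : sphere (0 : E) 1 =>
      radialWeight q (wulffGauge H (u : E))⁻¹ * φ (wulffNormal H (u : E)))
        (volume : Measure E).toSphere :=
    ((continuous_radialWeight hq).comp (continuous_inv_wulffGauge_coe hH hpos)).aemeasurable.mul
      (hφ.measurable.comp_aemeasurable (aemeasurable_wulffNormal_coe hH hpos))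
  obtain ⟨L, hL⟩ := exists_lipschitzOnWith_radialPrimitive_inv_wulffGauge hq hH hpos hφ
  refine (hasDerivAt_integral_of_dominated_loc_of_lip (bound := fun _ => (L : ℝ))
    (ball_mem_nhds (0 : ℝ) one_pos) (Eventually.of_forall fun t => (hcont t).aestronglyMeasurable)
    ((hcont 0).integrable_of_hasCompactSupport (.of_compactSpace _)) hweight.aestronglyMeasurable
    (Eventually.of_forall fun u => by simpa using hL u) (integrable_const _) ?_).2
  filter_upwards [ae_toSphere_mem_regularDirs hH hpos] with u hu
  exact hasDerivAt_radialPrimitive_inv_wulffGauge hq hH hpos hφ hu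

end Variation

theorem hasDerivAt_integral_mul_exp {X : Type*} [TopologicalSpace X] [CompactSpace X]
    [MeasurableSpace X] [OpensMeasurableSpace X] {μ : Measure X} [IsFiniteMeasure μ] {f g : X → ℝ}
    (hf : Continuous f) (hg : Continuous g) :
    HasDerivAt (fun t => ∫ x, f x * Real.exp (t * g x) ∂μ) (∫ x, f x * g x ∂μ) 0 := by
  refine ((hasDerivAt_integral_of_dominated_loc_of_deriv_le (x₀ := (0 : ℝ))
    (F := fun t x => f x * Real.exp (t * g x))
    (F' := fun t x => f x * (Real.exp (t * g x) * g x))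
    (bound := fun x => |f x| * (Real.exp |g x| * |g x|)) (ball_mem_nhds (0 : ℝ) one_pos)
    (Eventually.of_forall fun t => Continuous.aestronglyMeasurable (by fun_prop))
    (Continuous.integrable_of_hasCompactSupport (by fun_prop) (.of_compactSpace _))
    (Continuous.aestronglyMeasurable (by fun_prop)) (Eventually.of_forall fun x t ht => ?_)
    (Continuous.integrable_of_hasCompactSupport (by fun_prop) (.of_compactSpace _))
    (Eventually.of_forall fun x t _ => ?_)).2).congr_deriv (by simp)
  · rw [Real.norm_eq_abs, abs_mul, abs_mul, Real.abs_exp]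
    gcongr
    calc t * g x ≤ |t| * |g x| := abs_mul t (g x) ▸ le_abs_self _
      _ ≤ |g x| := mul_le_of_le_one_left (abs_nonneg _) (mem_ball_zero_iff.1 ht).le
  · simpa using (((hasDerivAt_id t).mul_const (g x)).exp).const_mul (f x)

section Support

variable {E : Type*} [NormedAddCommGroup E] [InnerProductSpace ℝ E] {K : Set E}
  {H : sphere (0 : E) 1 → ℝ}

/-- The support function of `K`, restricted to the unit sphere. -/
def sphereSupport (K : Set E) (v : sphere (0 : E) 1) : ℝ :=
  sSup ((fun y => inner ℝ (v : E) y) '' K)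

theorem inner_le_sphereSupport (hK : IsCompact K) {y : E} (hy : y ∈ K) (v : sphere (0 : E) 1) :
    inner ℝ y (v : E) ≤ sphereSupport K v := by
  rw [real_inner_comm]
  exact le_csSup (hK.bddAbove_image (by fun_prop)) (mem_image_of_mem _ hy)

theorem sphereSupport_le (hne : K.Nonempty) {v : sphere (0 : E) 1} {a : ℝ}
    (h : ∀ y ∈ K, inner ℝ y (v : E) ≤ a) : sphereSupport K v ≤ a :=
  csSup_le (hne.image _) (forall_mem_image.2 fun y hy => real_inner_comm y (v : E) ▸ h y hy)

theorem sphereSupport_neg (hsymm : ∀ x ∈ K, -x ∈ K) (v : sphere (0 : E) 1) :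
    sphereSupport K (-v) = sphereSupport K v := by
  have hneg : -K = K := Subset.antisymm (fun x hx => neg_neg x ▸ hsymm _ hx) hsymm
  rw [sphereSupport, sphereSupport, ← hneg, ← image_neg_eq_neg, image_image, image_neg_eq_neg, hneg]
  simp

theorem continuous_sphereSupport (hK : IsCompact K) (hne : K.Nonempty) :
    Continuous (sphereSupport K) := by
  obtain ⟨R, hR⟩ := hK.exists_bound_of_continuousOn continuousOn_id
  refine (LipschitzWith.of_le_add_mul R.toNNReal fun v w =>
    sphereSupport_le hne fun y hy => ?_).continuous
  have hdiff : inner ℝ y ((v : E) - w) ≤ R.toNNReal * dist v w :=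
    calc inner ℝ y ((v : E) - w) ≤ ‖y‖ * ‖(v : E) - w‖ := real_inner_le_norm _ _
      _ ≤ R.toNNReal * dist v w := by
        rw [Subtype.dist_eq, dist_eq_norm]
        gcongr
        exact (hR y hy).trans R.le_coe_toNNReal
  rw [inner_sub_right] at hdiff
  linarith [inner_le_sphereSupport hK hy w]

theorem sphereSupport_wulffShape_le (hpos : ∀ v, 0 < H v) (v : sphere (0 : E) 1) :
    sphereSupport (wulffShape H) v ≤ H v :=
  sphereSupport_le ⟨0, fun w => by simpa using (hpos w).le⟩ fun _ hy => hy v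

/-- Nonempty compact convex sets that are symmetric about the origin; unlike a convex body, such a
set may have empty interior. -/
structure IsSymmConvexCompact (K : Set E) : Prop where
  isCompact : IsCompact K
  convex : Convex ℝ K
  nonempty : K.Nonempty
  neg_mem : ∀ x ∈ K, -x ∈ K

namespace IsSymmConvexCompact

theorem zero_mem (hK : IsSymmConvexCompact K) : 0 ∈ K := by
  obtain ⟨x, hx⟩ := hK.nonempty
  simpa using hK.convex.midpoint_mem hx (hK.neg_mem x hx)

theorem abs_inner_le_sphereSupport (hK : IsSymmConvexCompact K) {y : E} (hy : y ∈ K)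
    (v : sphere (0 : E) 1) : |inner ℝ y (v : E)| ≤ sphereSupport K v := by
  refine abs_le'.2 ⟨inner_le_sphereSupport hK.isCompact hy v, ?_⟩
  rw [← inner_neg_left]
  exact inner_le_sphereSupport hK.isCompact (hK.neg_mem y hy) v

theorem sphereSupport_nonneg (hK : IsSymmConvexCompact K) (v : sphere (0 : E) 1) :
    0 ≤ sphereSupport K v :=
  (abs_nonneg _).trans (hK.abs_inner_le_sphereSupport hK.zero_mem v)

end IsSymmConvexCompact

variable [FiniteDimensional ℝ E]

theorem exists_sphereSupport_lt_inner (hK : IsCompact K) (hconv : Convex ℝ K) (hne : K.Nonempty)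
    {x : E} (hx : x ∉ K) : ∃ v, sphereSupport K v < inner ℝ x (v : E) := by
  obtain ⟨f, a, hfa, hax⟩ := geometric_hahn_banach_closed_point hconv hK.isClosed hx
  obtain ⟨w, rfl⟩ := (InnerProductSpace.toDual ℝ E).surjective f
  simp only [InnerProductSpace.toDual_apply_apply] at hfa hax
  have hw : w ≠ 0 := by
    rintro rfl
    obtain ⟨y, hy⟩ := hne
    have := hfa y hy
    simp only [inner_zero_left] at this hax
    exact this.not_gt hax
  have := inv_pos.2 (norm_pos_iff.2 hw)
  refine ⟨⟨‖w‖⁻¹ • w, by simp [norm_smul, hw]⟩, ?_⟩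
  calc sphereSupport K _ ≤ ‖w‖⁻¹ * a := sphereSupport_le hne fun y hy => by
        rw [real_inner_smul_right, real_inner_comm]
        gcongr
        exact (hfa y hy).le
    _ < ‖w‖⁻¹ * inner ℝ w x := by gcongr
    _ = inner ℝ x (‖w‖⁻¹ • w) := by rw [real_inner_smul_right, real_inner_comm]

theorem wulffShape_sphereSupport (hK : IsCompact K) (hconv : Convex ℝ K) (hne : K.Nonempty) :
    wulffShape (sphereSupport K) = K := by
  refine Subset.antisymm (fun x hx => ?_) fun x hx v => inner_le_sphereSupport hK hx v
  by_contra hxK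
  obtain ⟨v, hv⟩ := exists_sphereSupport_lt_inner hK hconv hne hxK
  exact (hx v).not_gt hv

theorem zero_mem_interior_wulffShape (hH : Continuous H) (hpos : ∀ v, 0 < H v) :
    0 ∈ interior (wulffShape H) := by
  obtain ⟨a, ha, hle⟩ := exists_pos_forall_le hH hpos
  refine mem_interior_iff_mem_nhds.2 (mem_of_superset (ball_mem_nhds _ ha) fun x hx v => ?_)
  calc inner ℝ x (v : E) ≤ ‖x‖ := by simpa using real_inner_le_norm x (v : E)
    _ ≤ a := (mem_ball_zero_iff.1 hx).le
    _ ≤ H v := hle v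

theorem IsSymmConvexCompact.sphereSupport_pos [MeasurableSpace E] [BorelSpace E]
    (hK : IsSymmConvexCompact K)
    (hvol : volume K ≠ 0) (v : sphere (0 : E) 1) : 0 < sphereSupport K v := by
  refine (hK.sphereSupport_nonneg v).lt_of_ne fun hzero => hvol ?_
  refine measure_mono_null (t := ((ℝ ∙ (v : E))ᗮ : Submodule ℝ E)) (fun y hy => ?_)
    (Measure.addHaar_submodule volume _ fun htop => ?_)
  · have habs := hK.abs_inner_le_sphereSupport hy v
    rw [← hzero, abs_nonpos_iff] at habs
    rwa [SetLike.mem_coe, Submodule.mem_orthogonal_singleton_iff_inner_left]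
  · rw [Submodule.orthogonal_eq_top_iff, Submodule.span_singleton_eq_bot] at htop
    exact ne_zero_of_mem_unit_sphere v htop

variable [Nontrivial E]

theorem isSymmConvexCompact_wulffShape (hH : Continuous H) (hpos : ∀ v, 0 < H v)
    (heven : ∀ v, H (-v) = H v) : IsSymmConvexCompact (wulffShape H) where
  isCompact := by
    obtain ⟨b, hb0, hb⟩ := exists_pos_forall_ge hH
    refine (isCompact_closedBall 0 b).of_isClosed_subset isClosed_wulffShape fun x hx => ?_
    rw [mem_closedBall_zero_iff]
    exact (norm_le_mul_wulffGauge hH hpos hb x).trans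
      (mul_le_of_le_one_right hb0.le ((mem_wulffShape_iff hH hpos).1 hx))
  convex := convex_wulffShape
  nonempty := ⟨0, interior_subset (zero_mem_interior_wulffShape hH hpos)⟩
  neg_mem _ := neg_mem_wulffShape heven

end Support

section Existence

open TopologicalSpace (NonemptyCompacts)

section HausdorffMetric

theorem isClosed_setOf_apply_le_self {X : Type*} [TopologicalSpace X] [T2Space X]
    {F : NonemptyCompacts X → NonemptyCompacts X} (hF : Continuous F) :
    IsClosed {K | F K ≤ K} := by
  simpa only [sup_eq_right, id] using isClosed_eq (hF.sup continuous_id) continuous_id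

theorem isClosed_setOf_le_measure {X : Type*} [MetricSpace X] [ProperSpace X]
    [MeasurableSpace X] [OpensMeasurableSpace X] (m : Measure X) [IsFiniteMeasureOnCompacts m]
    (c : ℝ≥0∞) : IsClosed {K : NonemptyCompacts X | c ≤ m (K : Set X)} := by
  refine IsSeqClosed.isClosed fun K L hK hKL => ?_
  have hdist : Tendsto (fun j => dist (K j) L) atTop (𝓝 0) := tendsto_iff_dist_tendsto_zero.1 hKL
  refine ge_of_tendsto ((tendsto_measure_cthickening_of_isCompact L.isCompact).comp hdist)
    (Eventually.of_forall fun j => (hK j).trans (measure_mono fun x hx => ?_))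
  obtain ⟨z, hz, hxz⟩ := L.isCompact.exists_infDist_eq_dist L.nonempty x
  refine mem_cthickening_of_dist_le x z _ _ hz ?_
  exact hxz ▸ infDist_le_hausdorffDist_of_mem hx (edist_ne_top (K j) L)

end HausdorffMetric

variable {E : Type*} [NormedAddCommGroup E] [InnerProductSpace ℝ E]

theorem isClosed_setOf_isSymmConvexCompact :
    IsClosed {K : NonemptyCompacts E | IsSymmConvexCompact (K : Set E)} := by
  have hconvex : IsClosed {K : NonemptyCompacts E | Convex ℝ (K : Set E)} := by
    have hcomb : ∀ a b : ℝ, Continuous fun x : E × E => a • x.1 + b • x.2 := fun a b => by fun_prop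
    convert isClosed_iInter fun a : ℝ => isClosed_iInter fun b : ℝ =>
      isClosed_iInter fun _ : 0 ≤ a => isClosed_iInter fun _ : 0 ≤ b =>
      isClosed_iInter fun _ : a + b = 1 => isClosed_setOf_apply_le_self
        ((hcomb a b).nonemptyCompacts_map.comp
          (NonemptyCompacts.continuous_prod.comp (continuous_id.prodMk continuous_id))) using 1
    ext K
    simp only [convex_iff_add_mem, mem_iInter, mem_ofPred_eq]
    constructor
    · rintro h a b ha hb hab - ⟨x, ⟨hx₁, hx₂⟩, rfl⟩
      exact h hx₁ hx₂ ha hb hab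
    · exact fun h x hx y hy a b ha hb hab =>
        h a b ha hb hab (mem_image_of_mem (fun x : E × E => a • x.1 + b • x.2) (mk_mem_prod hx hy))
  have hneg : IsClosed {K : NonemptyCompacts E | ∀ x ∈ (K : Set E), -x ∈ (K : Set E)} := by
    convert isClosed_setOf_apply_le_self (continuous_neg (G := E)).nonemptyCompacts_map using 1
    ext K
    refine ⟨fun h => ?_, fun h x hx => h (mem_image_of_mem _ hx)⟩
    rintro - ⟨x, hx, rfl⟩
    exact h x hx
  convert hconvex.inter hneg using 1
  ext K
  exact ⟨fun hK => ⟨hK.convex, hK.neg_mem⟩, fun hK => ⟨K.isCompact, hK.1, K.nonempty, hK.2⟩⟩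

theorem sphereSupport_le_add_dist (K L : NonemptyCompacts E) (v : sphere (0 : E) 1) :
    sphereSupport (K : Set E) v ≤ sphereSupport (L : Set E) v + dist K L := by
  refine sphereSupport_le K.nonempty fun y hy => ?_
  obtain ⟨z, hz, hyz⟩ := L.isCompact.exists_infDist_eq_dist L.nonempty y
  calc inner ℝ y (v : E) = inner ℝ z (v : E) + inner ℝ (y - z) (v : E) := by
        rw [inner_sub_left, add_sub_cancel]
    _ ≤ sphereSupport (L : Set E) v + dist y z := by
        gcongr
        · exact inner_le_sphereSupport L.isCompact hz v
        · simpa [dist_eq_norm] using real_inner_le_norm (y - z) (v : E)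
    _ ≤ sphereSupport (L : Set E) v + dist K L := by
        gcongr
        exact hyz ▸ infDist_le_hausdorffDist_of_mem hy (edist_ne_top K L)

theorem continuous_uncurry_sphereSupport :
    Continuous fun a : NonemptyCompacts E × sphere (0 : E) 1 =>
      sphereSupport (a.1 : Set E) a.2 :=
  continuous_prod_of_continuous_lipschitzWith _ 1
    (fun K => continuous_sphereSupport K.isCompact K.nonempty)
    fun v => .of_le_add fun K L => sphereSupport_le_add_dist K L v

variable [FiniteDimensional ℝ E] [MeasurableSpace E] [BorelSpace E] {p : ℝ}
  {μ : Measure (sphere (0 : E) 1)}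

/-- The functional `K ↦ ∫ h_K ^ p dμ` whose constrained minimizers solve the `L_p` problem. -/
def lpSupportIntegral (p : ℝ) (μ : Measure (sphere (0 : E) 1)) (K : Set E) : ℝ :=
  ∫ v, sphereSupport K v ^ p ∂μ

variable [IsFiniteMeasure μ]

theorem continuous_lpSupportIntegral (hp : 0 < p) :
    Continuous fun K : NonemptyCompacts E => lpSupportIntegral p μ (K : Set E) := by
  simpa only [lpSupportIntegral, setIntegral_univ] using
    continuous_parametric_integral_of_continuous (μ := μ)
    (f := fun (K : NonemptyCompacts E) v => sphereSupport (K : Set E) v ^ p)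
    (continuous_uncurry_sphereSupport.rpow_const fun _ => Or.inr hp.le) isCompact_univ

theorem integrable_abs_inner_rpow (hp : 0 < p) (e : E) :
    Integrable (fun v : sphere (0 : E) 1 => |inner ℝ e (v : E)| ^ p) μ :=
  Continuous.integrable_of_hasCompactSupport
    (Continuous.rpow_const (by fun_prop) fun _ => Or.inr hp.le) (.of_compactSpace _)

theorem integral_abs_inner_rpow_pos (hp : 0 < p) {e : E}
    (hμ : ∃ᵐ v : sphere (0 : E) 1 ∂μ, inner ℝ e (v : E) ≠ 0) :
    0 < ∫ v, |inner ℝ e (v : E)| ^ p ∂μ := by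
  have hnonneg : ∀ v : sphere (0 : E) 1, 0 ≤ |inner ℝ e (v : E)| ^ p := fun v => by positivity
  refine (integral_nonneg hnonneg).lt_of_ne fun hzero => hμ ?_
  filter_upwards [(integral_eq_zero_iff_of_nonneg hnonneg (integrable_abs_inner_rpow hp e)).1
    hzero.symm] with v hv
  simpa [Real.rpow_eq_zero (abs_nonneg _) hp.ne'] using hv

theorem exists_pos_mul_norm_rpow_le_integral_abs_inner_rpow (hp : 0 < p)
    (hμ : ∀ e : E, e ≠ 0 → ∃ᵐ v : sphere (0 : E) 1 ∂μ, inner ℝ e (v : E) ≠ 0) :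
    ∃ a, 0 < a ∧ ∀ e : E, a * ‖e‖ ^ p ≤ ∫ v, |inner ℝ e (v : E)| ^ p ∂μ := by
  have hcont : Continuous fun e : E => ∫ v, |inner ℝ e (v : E)| ^ p ∂μ := by
    simpa only [setIntegral_univ] using continuous_parametric_integral_of_continuous (μ := μ)
      (f := fun (e : E) v => |inner ℝ e (v : E)| ^ p)
      (Continuous.rpow_const (by fun_prop) fun _ => Or.inr hp.le) isCompact_univ
  obtain ⟨a, ha, hle⟩ := exists_pos_forall_le (hcont.comp continuous_subtype_val)
    fun u : sphere (0 : E) 1 =>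
      integral_abs_inner_rpow_pos hp (hμ u (ne_zero_of_mem_unit_sphere u))
  refine ⟨a, ha, fun e => ?_⟩
  rcases eq_or_ne e 0 with rfl | he
  · simp [Real.zero_rpow hp.ne']
  have hunit : ‖‖e‖⁻¹ • e‖ = 1 := by simp [norm_smul, he]
  calc a * ‖e‖ ^ p
      ≤ (∫ v, |inner ℝ (‖e‖⁻¹ • e) (v : E)| ^ p ∂μ) * ‖e‖ ^ p := by
        gcongr
        exact hle ⟨‖e‖⁻¹ • e, by simpa using hunit⟩
    _ = ∫ v, |inner ℝ e (v : E)| ^ p ∂μ := by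
        rw [← integral_mul_const]
        refine integral_congr_ae (Eventually.of_forall fun v => ?_)
        simp only
        rw [← Real.mul_rpow (abs_nonneg _) (norm_nonneg _), real_inner_smul_left, abs_mul,
          abs_inv, abs_norm, inv_mul_eq_div, div_mul_cancel₀ _ (norm_ne_zero_iff.2 he)]

theorem exists_forall_subset_closedBall_of_lpSupportIntegral_le (hp : 0 < p)
    (hμ : ∀ e : E, e ≠ 0 → ∃ᵐ v : sphere (0 : E) 1 ∂μ, inner ℝ e (v : E) ≠ 0) (c : ℝ) :
    ∃ R, ∀ K : Set E, IsSymmConvexCompact K → lpSupportIntegral p μ K ≤ c →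
      K ⊆ closedBall 0 R := by
  obtain ⟨a, ha, hcoercive⟩ := exists_pos_mul_norm_rpow_le_integral_abs_inner_rpow hp hμ
  refine ⟨(c / a) ^ p⁻¹, fun K hK hKc y hy => ?_⟩
  have hsupport : Integrable (fun v => sphereSupport K v ^ p) μ :=
    ((continuous_sphereSupport hK.isCompact hK.nonempty).rpow_const fun _ =>
      Or.inr hp.le).integrable_of_hasCompactSupport (.of_compactSpace _)
  have hle : a * ‖y‖ ^ p ≤ c :=
    calc a * ‖y‖ ^ p ≤ ∫ v, |inner ℝ y (v : E)| ^ p ∂μ := hcoercive y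
      _ ≤ lpSupportIntegral p μ K :=
        integral_mono (integrable_abs_inner_rpow hp y) hsupport fun v =>
          Real.rpow_le_rpow (abs_nonneg _) (hK.abs_inner_le_sphereSupport hy v) hp.le
      _ ≤ c := hKc
  rw [mem_closedBall_zero_iff, ← Real.rpow_rpow_inv (norm_nonneg y) hp.ne']
  gcongr
  exact (le_div_iff₀' ha).2 hle

theorem exists_isMinOn_lpSupportIntegral (hp : 0 < p)
    (hμ : ∀ e : E, e ≠ 0 → ∃ᵐ v : sphere (0 : E) 1 ∂μ, inner ℝ e (v : E) ≠ 0) {m : Measure E}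
    [IsFiniteMeasureOnCompacts m] {c : ℝ≥0∞} {B : Set E} (hB : IsSymmConvexCompact B)
    (hcB : c ≤ m B) :
    ∃ K ∈ {K | IsSymmConvexCompact K ∧ c ≤ m K},
      IsMinOn (lpSupportIntegral p μ) {K | IsSymmConvexCompact K ∧ c ≤ m K} K := by
  obtain ⟨R, hR⟩ := exists_forall_subset_closedBall_of_lpSupportIntegral_le hp hμ
    (lpSupportIntegral p μ B)
  have hcompact : IsCompact ({K : NonemptyCompacts E | (K : Set E) ⊆ closedBall 0 R} ∩
      ({K | IsSymmConvexCompact (K : Set E)} ∩ {K | c ≤ m (K : Set E)})) :=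
    (NonemptyCompacts.isCompact_subsets_of_isCompact (isCompact_closedBall 0 R)).inter_right
      (isClosed_setOf_isSymmConvexCompact.inter (isClosed_setOf_le_measure m c))
  obtain ⟨K, ⟨-, hK, hcK⟩, hmin⟩ := hcompact.exists_isMinOn
    ⟨⟨⟨B, hB.isCompact⟩, hB.nonempty⟩, hR B hB le_rfl, hB, hcB⟩
    (continuous_lpSupportIntegral (μ := μ) hp).continuousOn
  have hmin' : ∀ L, IsSymmConvexCompact L → c ≤ m L →
      lpSupportIntegral p μ L ≤ lpSupportIntegral p μ B →
        lpSupportIntegral p μ K ≤ lpSupportIntegral p μ L := fun L hL hcL hLB =>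
    hmin (a := ⟨⟨L, hL.isCompact⟩, hL.nonempty⟩) ⟨hR L hL hLB, hL, hcL⟩
  refine ⟨K, ⟨hK, hcK⟩, fun L hL => ?_⟩
  rcases le_total (lpSupportIntegral p μ L) (lpSupportIntegral p μ B) with hLB | hBL
  · exact hmin' L hL.1 hL.2 hLB
  · exact (hmin' B hB hcB le_rfl).trans hBL

theorem isFiniteMeasureOnCompacts_gaussDualMeasure [Nontrivial E] {q : ℝ} (hq : 0 < q) :
    IsFiniteMeasureOnCompacts (gaussDualMeasure E q) := by
  refine ⟨fun C hC => ?_⟩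
  obtain ⟨R, hR⟩ := hC.exists_bound_of_continuousOn continuousOn_id
  have hsub : C ⊆ wulffShape fun _ => max R 1 := fun x hx v =>
    calc inner ℝ x (v : E) ≤ ‖x‖ := by simpa using real_inner_le_norm x (v : E)
      _ ≤ max R 1 := (hR x hx).trans (le_max_left _ _)
  refine (measure_mono hsub).trans_lt ?_
  rw [gaussDualMeasure_wulffShape hq continuous_const fun _ => by positivity]
  exact ENNReal.ofReal_lt_top

end Existence

section EvenMeasures

variable {X : Type*} [MeasurableSpace X]

theorem isNegInvariant_withDensity [Neg X] [MeasurableNeg X] {m : Measure X} [m.IsNegInvariant]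
    {f : X → ℝ≥0∞} (hf : Measurable f) (hfeven : ∀ x, f (-x) = f x) :
    (m.withDensity f).IsNegInvariant := by
  refine ⟨Measure.ext fun s hs => ?_⟩
  have hneg := Measure.measurePreserving_neg m
  rw [Measure.neg, Measure.map_apply measurable_neg hs, withDensity_apply _ (measurable_neg hs),
    withDensity_apply _ hs, ← hneg.setLIntegral_comp_preimage hs hf]
  simp only [hfeven]

theorem integral_comp_neg_eq_self [InvolutiveNeg X] [MeasurableNeg X] (m : Measure X)
    [m.IsNegInvariant] (f : X → ℝ) : ∫ x, f (-x) ∂m = ∫ x, f x ∂m :=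
  (Measure.measurePreserving_neg m).integral_comp' (f := MeasurableEquiv.neg X) f

variable [TopologicalSpace X] [CompactSpace X] [T2Space X] [SecondCountableTopology X]
  [BorelSpace X] [InvolutiveNeg X]

theorem integral_le_integral_of_even {κ ν : Measure X} [IsProbabilityMeasure κ]
    [IsProbabilityMeasure ν]
    (h : ∀ φ : X → ℝ, Continuous φ → (∀ x, φ (-x) = φ x) → 0 < ∫ x, φ x ∂κ → 0 ≤ ∫ x, φ x ∂ν)
    {φ : X → ℝ} (hφ : Continuous φ) (hφeven : ∀ x, φ (-x) = φ x) :
    ∫ x, φ x ∂κ ≤ ∫ x, φ x ∂ν := by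
  have hint : ∀ m : Measure X, [IsProbabilityMeasure m] → ∀ a : ℝ,
      ∫ x, φ x - a ∂m = ∫ x, φ x ∂m - a := fun m _ a => by
    rw [integral_sub (hφ.integrable_of_hasCompactSupport (.of_compactSpace _))
      (integrable_const a), integral_const, probReal_univ, one_smul]
  refine le_of_forall_lt_imp_le_of_dense fun a ha => ?_
  have := h (fun x => φ x - a) (hφ.sub continuous_const) (fun x => by rw [hφeven])
    (by rw [hint κ]; exact sub_pos.2 ha)
  rwa [hint ν, sub_nonneg] at this

variable [ContinuousNeg X] [HasOuterApproxClosed X]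

theorem eq_of_forall_even_integral_nonneg {κ ν : Measure X} [IsProbabilityMeasure κ]
    [IsProbabilityMeasure ν] [κ.IsNegInvariant] [ν.IsNegInvariant]
    (h : ∀ φ : X → ℝ, Continuous φ → (∀ x, φ (-x) = φ x) → 0 < ∫ x, φ x ∂κ → 0 ≤ ∫ x, φ x ∂ν) :
    ν = κ := by
  have heven : ∀ φ : X → ℝ, Continuous φ → (∀ x, φ (-x) = φ x) →
      ∫ x, φ x ∂ν = ∫ x, φ x ∂κ := fun φ hφ hφeven => by
    refine le_antisymm ?_ (integral_le_integral_of_even h hφ hφeven)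
    simpa only [integral_neg, neg_le_neg_iff] using
      integral_le_integral_of_even h (φ := fun x => -φ x) hφ.neg fun x => by rw [hφeven]
  refine ext_of_forall_integral_eq_of_IsFiniteMeasure fun f => ?_
  have hsymm : ∀ m : Measure X, [IsProbabilityMeasure m] → [m.IsNegInvariant] →
      ∫ x, f x + f (-x) ∂m = 2 * ∫ x, f x ∂m := fun m _ _ => by
    have hint : ∀ g : X → ℝ, Continuous g → Integrable g m := fun g hg =>
      hg.integrable_of_hasCompactSupport (.of_compactSpace _)
    rw [integral_add (hint _ f.continuous)
        (hint (fun x => f (-x)) (f.continuous.comp continuous_neg)),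
      integral_comp_neg_eq_self, two_mul]
  have := heven (fun x => f x + f (-x)) (f.continuous.add (f.continuous.comp continuous_neg))
    fun x => by rw [neg_neg, add_comm]
  rw [hsymm ν, hsymm κ] at this
  linarith

theorem exists_eq_smul_of_forall_even_integral_nonneg {κ ν : Measure X} [IsFiniteMeasure κ]
    [IsFiniteMeasure ν] [NeZero κ] [NeZero ν] [κ.IsNegInvariant] [ν.IsNegInvariant]
    (h : ∀ φ : X → ℝ, Continuous φ → (∀ x, φ (-x) = φ x) → 0 < ∫ x, φ x ∂κ → 0 ≤ ∫ x, φ x ∂ν) :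
    ∃ c : ℝ≥0∞, c ≠ 0 ∧ c ≠ ∞ ∧ ν = c • κ := by
  have hnormalized : (ν univ)⁻¹ • ν = (κ univ)⁻¹ • κ := by
    have hsmul : ∀ (m : Measure X) (c : ℝ≥0∞), [m.IsNegInvariant] → (c • m).IsNegInvariant :=
      fun m c _ => ⟨by rw [Measure.neg, Measure.map_smul, Measure.map_neg_eq_self]⟩
    have := hsmul κ (κ univ)⁻¹
    have := hsmul ν (ν univ)⁻¹
    refine eq_of_forall_even_integral_nonneg fun φ hφ hφeven hκφ => ?_
    rw [integral_smul_measure, smul_eq_mul] at hκφ ⊢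
    exact mul_nonneg ENNReal.toReal_nonneg
      (h φ hφ hφeven (pos_of_mul_pos_right hκφ ENNReal.toReal_nonneg))
  have hν : ν univ ≠ 0 := Measure.measure_univ_ne_zero.2 (NeZero.ne ν)
  refine ⟨ν univ * (κ univ)⁻¹, mul_ne_zero hν (ENNReal.inv_ne_zero.2 (measure_ne_top κ _)),
    ENNReal.mul_ne_top (measure_ne_top ν _)
      (ENNReal.inv_ne_top.2 (Measure.measure_univ_ne_zero.2 (NeZero.ne κ))), ?_⟩
  rw [mul_smul, ← hnormalized, smul_smul, ENNReal.mul_inv_cancel hν (measure_ne_top ν _), one_smul]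

end EvenMeasures

section EulerLagrange

theorem eventually_lt_of_hasDerivAt_pos {f : ℝ → ℝ} {f' : ℝ} (hf : HasDerivAt f f' 0)
    (hf' : 0 < f') : ∀ᶠ t in 𝓝[>] 0, f 0 < f t := by
  have hslope : Tendsto (slope f 0) (𝓝[>] 0) (𝓝 f') :=
    (hasDerivAt_iff_tendsto_slope.1 hf).mono_left
      (nhdsWithin_mono 0 fun _ (ht : (0 : ℝ) < _) => ht.ne')
  filter_upwards [hslope.eventually_const_lt hf', self_mem_nhdsWithin] with t ht ht0
  rw [slope_def_field, sub_zero] at ht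
  exact sub_pos.1 ((div_pos_iff_of_pos_right ht0).1 ht)

theorem nonneg_of_hasDerivAt_of_forall_lt_imp_le {f g : ℝ → ℝ} {f' g' : ℝ}
    (hf : HasDerivAt f f' 0) (hg : HasDerivAt g g' 0) (hf' : 0 < f')
    (h : ∀ t, f 0 < f t → g 0 ≤ g t) : 0 ≤ g' := by
  by_contra! hneg
  obtain ⟨t, hft, hgt⟩ := ((eventually_lt_of_hasDerivAt_pos hf hf').and
    (eventually_lt_of_hasDerivAt_pos hg.neg (neg_pos.2 hneg))).exists
  exact (neg_lt_neg_iff.1 hgt).not_ge (h t hft)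

variable {E : Type*} [NormedAddCommGroup E] [InnerProductSpace ℝ E] [FiniteDimensional ℝ E]
  {H φ : sphere (0 : E) 1 → ℝ} {p q : ℝ}

theorem radialWeight_inv_wulffGauge_pos (hH : Continuous H) (hpos : ∀ v, 0 < H v)
    (u : sphere (0 : E) 1) : 0 < radialWeight q (wulffGauge H (u : E))⁻¹ :=
  radialWeight_pos (inv_pos.2 (wulffGauge_coe_pos hH hpos u))

theorem continuous_radialWeight_inv_wulffGauge [Nontrivial E] (hq : 0 < q) (hH : Continuous H)
    (hpos : ∀ v, 0 < H v) :
    Continuous fun u : sphere (0 : E) 1 => radialWeight q (wulffGauge H (u : E))⁻¹ :=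
  (continuous_radialWeight hq).comp (continuous_inv_wulffGauge_coe hH hpos)

variable [MeasurableSpace E] [BorelSpace E]

theorem isNegInvariant_toSphere : (volume : Measure E).toSphere.IsNegInvariant := by
  refine ⟨Measure.ext fun s hs => ?_⟩
  have hneg : ((↑) '' (Neg.neg ⁻¹' s : Set (sphere (0 : E) 1)) : Set E) = -((↑) '' s) := by
    ext x
    constructor
    · rintro ⟨u, hu, rfl⟩
      exact ⟨-u, hu, rfl⟩
    · rintro ⟨u, hu, hx⟩
      exact ⟨-u, by simpa using hu, by simpa using congrArg Neg.neg hx⟩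
  rw [Measure.neg, Measure.map_apply measurable_neg hs,
    Measure.toSphere_apply' _ (measurable_neg hs), Measure.toSphere_apply' _ hs, hneg,
    Set.smul_neg, Measure.measure_neg]

variable [Nontrivial E]

/-- The Gaussian dual curvature measure of the Wulff shape of `H`, for the exponent `p = 0` and up
to normalization, in polar coordinates: the image under the Gauss map of the measure with density
`radialWeight` at the radial function `(wulffGauge H u)⁻¹`. -/
def gaussDualCurvature (q : ℝ) (H : sphere (0 : E) 1 → ℝ) : Measure (sphere (0 : E) 1) :=
  ((volume : Measure E).toSphere.withDensity fun u : sphere (0 : E) 1 =>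
    ENNReal.ofReal (radialWeight q (wulffGauge H (u : E))⁻¹)).map fun u : sphere (0 : E) 1 =>
      wulffNormal H (u : E)

theorem aemeasurable_wulffNormal_coe_withDensity (hH : Continuous H) (hpos : ∀ v, 0 < H v)
    (f : sphere (0 : E) 1 → ℝ≥0∞) :
    AEMeasurable (fun u : sphere (0 : E) 1 => wulffNormal H (u : E))
      ((volume : Measure E).toSphere.withDensity f) :=
  (aemeasurable_wulffNormal_coe hH hpos).mono_ac (withDensity_absolutelyContinuous _ _)

theorem isFiniteMeasure_gaussDualCurvature (hq : 0 < q) (hH : Continuous H)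
    (hpos : ∀ v, 0 < H v) : IsFiniteMeasure (gaussDualCurvature q H) := by
  have := isFiniteMeasure_withDensity_ofReal (Continuous.integrable_of_hasCompactSupport
    (μ := (volume : Measure E).toSphere) (continuous_radialWeight_inv_wulffGauge hq hH hpos)
    (.of_compactSpace _)).hasFiniteIntegral
  exact Measure.isFiniteMeasure_map _ _

theorem neZero_gaussDualCurvature (hq : 0 < q) (hH : Continuous H) (hpos : ∀ v, 0 < H v) :
    NeZero (gaussDualCurvature q H) := by
  refine ⟨fun hzero => ?_⟩
  rw [gaussDualCurvature, Measure.map_eq_zero_iff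
      (aemeasurable_wulffNormal_coe_withDensity hH hpos _), withDensity_eq_zero_iff
      (continuous_radialWeight_inv_wulffGauge hq hH hpos).measurable.ennreal_ofReal.aemeasurable]
    at hzero
  have := Measure.toSphere_ne_zero (volume : Measure E)
  have := ae_neBot.2 this
  obtain ⟨u, hu⟩ := hzero.exists
  exact (ENNReal.ofReal_pos.2 (radialWeight_inv_wulffGauge_pos hH hpos u)).ne' hu

theorem isNegInvariant_gaussDualCurvature (hq : 0 < q) (hH : Continuous H)
    (hpos : ∀ v, 0 < H v) (heven : ∀ v, H (-v) = H v) :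
    (gaussDualCurvature q H).IsNegInvariant := by
  have := isNegInvariant_toSphere (E := E)
  set W := (volume : Measure E).toSphere.withDensity fun u : sphere (0 : E) 1 =>
    ENNReal.ofReal (radialWeight q (wulffGauge H (u : E))⁻¹)
  have : W.IsNegInvariant := isNegInvariant_withDensity
    (continuous_radialWeight_inv_wulffGauge hq hH hpos).measurable.ennreal_ofReal fun u => by
      rw [coe_neg_sphere, wulffGauge_neg heven]
  have hN : AEMeasurable (fun u : sphere (0 : E) 1 => wulffNormal H (u : E)) W :=
    aemeasurable_wulffNormal_coe_withDensity hH hpos _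
  have hodd : ∀ᵐ u : sphere (0 : E) 1 ∂W,
      -wulffNormal H (u : E) = wulffNormal H ((-u : sphere (0 : E) 1) : E) := by
    filter_upwards [(withDensity_absolutelyContinuous _ _).ae_le
      (ae_toSphere_mem_regularDirs hH hpos)] with u hu
    exact (wulffNormal_neg hH hpos heven hu).symm
  constructor
  calc (W.map fun u : sphere (0 : E) 1 => wulffNormal H (u : E)).map Neg.neg
      = W.map fun u : sphere (0 : E) 1 => -wulffNormal H (u : E) :=
        AEMeasurable.map_map_of_aemeasurable measurable_neg.aemeasurable hN
    _ = W.map fun u : sphere (0 : E) 1 => wulffNormal H ((-u : sphere (0 : E) 1) : E) :=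
        Measure.map_congr hodd
    _ = (W.map Neg.neg).map fun u : sphere (0 : E) 1 => wulffNormal H (u : E) := by
        have hN' : AEMeasurable (fun u : sphere (0 : E) 1 => wulffNormal H (u : E))
            (W.map Neg.neg) := by rwa [Measure.map_neg_eq_self]
        exact (AEMeasurable.map_map_of_aemeasurable hN' measurable_neg.aemeasurable).symm
    _ = W.map fun u : sphere (0 : E) 1 => wulffNormal H (u : E) := by rw [Measure.map_neg_eq_self]

theorem integral_gaussDualCurvature (hq : 0 < q) (hH : Continuous H) (hpos : ∀ v, 0 < H v)
    (hφ : Continuous φ) :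
    ∫ v, φ v ∂gaussDualCurvature q H = ∫ u : sphere (0 : E) 1,
      radialWeight q (wulffGauge H (u : E))⁻¹ * φ (wulffNormal H (u : E))
        ∂(volume : Measure E).toSphere := by
  have hweight := continuous_radialWeight_inv_wulffGauge hq hH hpos
  rw [gaussDualCurvature, integral_map (aemeasurable_wulffNormal_coe_withDensity hH hpos _)
      hφ.aestronglyMeasurable,
    integral_withDensity_eq_integral_toReal_smul hweight.measurable.ennreal_ofReal
      (Eventually.of_forall fun _ => ENNReal.ofReal_lt_top)]
  refine integral_congr_ae (Eventually.of_forall fun u => ?_)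
  simp only
  rw [ENNReal.toReal_ofReal (radialWeight_inv_wulffGauge_pos hH hpos u).le, smul_eq_mul]

variable {K : Set E} {c : ℝ≥0∞} {μ : Measure (sphere (0 : E) 1)} [IsFiniteMeasure μ]

theorem lpSupportIntegral_wulffShape_le (hp : 0 < p) (hH : Continuous H) (hpos : ∀ v, 0 < H v)
    (heven : ∀ v, H (-v) = H v) : lpSupportIntegral p μ (wulffShape H) ≤ ∫ v, H v ^ p ∂μ := by
  have hW := isSymmConvexCompact_wulffShape hH hpos heven
  exact integral_mono
    (((continuous_sphereSupport hW.isCompact hW.nonempty).rpow_const fun _ =>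
      Or.inr hp.le).integrable_of_hasCompactSupport (.of_compactSpace _))
    ((hH.rpow_const fun _ => Or.inr hp.le).integrable_of_hasCompactSupport (.of_compactSpace _))
    fun v => Real.rpow_le_rpow (hW.sphereSupport_nonneg v) (sphereSupport_wulffShape_le hpos v)
      hp.le

theorem integral_rpow_mul_nonneg_of_isMinOn (hp : 0 < p) (hq : 0 < q)
    (hK : IsSymmConvexCompact K) (hcK : c ≤ gaussDualMeasure E q K)
    (hmin : IsMinOn (lpSupportIntegral p μ)
      {L | IsSymmConvexCompact L ∧ c ≤ gaussDualMeasure E q L} K)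
    (hpos : ∀ v, 0 < sphereSupport K v) (hφ : Continuous φ) (hφeven : ∀ v, φ (-v) = φ v)
    (hφpos : 0 < ∫ v, φ v ∂gaussDualCurvature q (sphereSupport K)) :
    0 ≤ ∫ v, sphereSupport K v ^ p * φ v ∂μ := by
  set H := sphereSupport K
  have hH : Continuous H := continuous_sphereSupport hK.isCompact hK.nonempty
  have hKH : wulffShape H = K := wulffShape_sphereSupport hK.isCompact hK.convex hK.nonempty
  rw [integral_gaussDualCurvature hq hH hpos hφ] at hφpos
  have hder : HasDerivAt (fun t => ∫ v, logVariation H φ t v ^ p ∂μ)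
      (∫ v, H v ^ p * (p * φ v) ∂μ) 0 := by
    simp only [logVariation_rpow hpos]
    exact hasDerivAt_integral_mul_exp (hH.rpow_const fun _ => Or.inr hp.le) (hφ.const_mul p)
  have hnonneg : 0 ≤ ∫ v, H v ^ p * (p * φ v) ∂μ := by
    refine nonneg_of_hasDerivAt_of_forall_lt_imp_le
      (hasDerivAt_integral_radialPrimitive hq hH hpos hφ) hder hφpos fun t ht => ?_
    have hHt := continuous_logVariation hH hφ t
    have hpost := logVariation_pos (φ := φ) hpos t
    have hevent := logVariation_neg (sphereSupport_neg hK.neg_mem) hφeven t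
    rw [logVariation_zero] at ht ⊢
    have hvolume : gaussDualMeasure E q K ≤ gaussDualMeasure E q (wulffShape (logVariation H φ t))
        := by
      rw [← hKH, gaussDualMeasure_wulffShape hq hH hpos, gaussDualMeasure_wulffShape hq hHt hpost]
      exact ENNReal.ofReal_le_ofReal ht.le
    exact (hmin ⟨isSymmConvexCompact_wulffShape hHt hpost hevent, hcK.trans hvolume⟩).trans
      (lpSupportIntegral_wulffShape_le hp hHt hpost hevent)
  simp only [mul_left_comm _ p, integral_const_mul] at hnonneg
  exact nonneg_of_mul_nonneg_right hnonneg hp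

theorem exists_withDensity_eq_smul_gaussDualCurvature_of_isMinOn [NeZero μ] [μ.IsNegInvariant]
    (hp : 0 < p) (hq : 0 < q) (hK : IsSymmConvexCompact K) (hcK : c ≤ gaussDualMeasure E q K)
    (hmin : IsMinOn (lpSupportIntegral p μ)
      {L | IsSymmConvexCompact L ∧ c ≤ gaussDualMeasure E q L} K)
    (hpos : ∀ v, 0 < sphereSupport K v) :
    ∃ a : ℝ≥0∞, a ≠ 0 ∧ a ≠ ∞ ∧
      (μ.withDensity fun v => ENNReal.ofReal (sphereSupport K v ^ p)) =
        a • gaussDualCurvature q (sphereSupport K) := by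
  set H := sphereSupport K
  have hH : Continuous H := continuous_sphereSupport hK.isCompact hK.nonempty
  have heven : ∀ v, H (-v) = H v := sphereSupport_neg hK.neg_mem
  have hHp : Continuous fun v => H v ^ p := hH.rpow_const fun _ => Or.inr hp.le
  have := isFiniteMeasure_gaussDualCurvature hq hH hpos
  have := neZero_gaussDualCurvature hq hH hpos
  have := isNegInvariant_gaussDualCurvature hq hH hpos heven
  have := isFiniteMeasure_withDensity_ofReal
    (hHp.integrable_of_hasCompactSupport (μ := μ) (.of_compactSpace _)).hasFiniteIntegral
  have : (μ.withDensity fun v => ENNReal.ofReal (H v ^ p)).IsNegInvariant :=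
    isNegInvariant_withDensity hHp.measurable.ennreal_ofReal fun v => by rw [heven]
  have : NeZero (μ.withDensity fun v => ENNReal.ofReal (H v ^ p)) := by
    refine ⟨fun hzero => ?_⟩
    obtain ⟨v, hv⟩ := ((withDensity_eq_zero_iff
      hHp.measurable.ennreal_ofReal.aemeasurable).1 hzero).exists
    exact (ENNReal.ofReal_pos.2 (Real.rpow_pos_of_pos (hpos v) p)).ne' hv
  refine exists_eq_smul_of_forall_even_integral_nonneg fun φ hφ hφeven hφpos => ?_
  rw [integral_withDensity_eq_integral_toReal_smul hHp.measurable.ennreal_ofReal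
    (Eventually.of_forall fun _ => ENNReal.ofReal_lt_top)]
  simp only [ENNReal.toReal_ofReal (Real.rpow_nonneg (hpos _).le p), smul_eq_mul]
  exact integral_rpow_mul_nonneg_of_isMinOn hp hq hK hcK hmin hpos hφ hφeven hφpos

theorem exists_eq_smul_gaussDualCurvature [μ.IsNegInvariant] (hp : 0 < p) (hq : 0 < q)
    (hμ : ∀ e : E, e ≠ 0 → ∃ᵐ v : sphere (0 : E) 1 ∂μ, inner ℝ e (v : E) ≠ 0) :
    ∃ K : Set E, IsSymmConvexCompact K ∧ (∀ v, 0 < sphereSupport K v) ∧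
      ∃ a : ℝ≥0∞, a ≠ 0 ∧ a ≠ ∞ ∧ μ = a • (gaussDualCurvature q (sphereSupport K)).withDensity
        fun v => ENNReal.ofReal (sphereSupport K v ^ (-p)) := by
  have : NeZero μ := by
    obtain ⟨e, he⟩ := exists_ne (0 : E)
    exact ⟨by rintro rfl; simpa using hμ e he⟩
  have := isFiniteMeasureOnCompacts_gaussDualMeasure (E := E) hq
  have hB : IsSymmConvexCompact (wulffShape fun _ : sphere (0 : E) 1 => 1) :=
    isSymmConvexCompact_wulffShape continuous_const (fun _ => one_pos) fun _ => rfl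
  have hvolB : gaussDualMeasure E q (wulffShape fun _ => 1) ≠ 0 := fun hzero =>
    (Measure.measure_pos_of_mem_nhds volume (mem_interior_iff_mem_nhds.1
      (zero_mem_interior_wulffShape continuous_const fun _ => one_pos))).ne'
        (volume_absolutelyContinuous_gaussDualMeasure hzero)
  obtain ⟨K, ⟨hK, hcK⟩, hmin⟩ := exists_isMinOn_lpSupportIntegral (m := gaussDualMeasure E q) hp
    hμ hB le_rfl
  have hpos : ∀ v, 0 < sphereSupport K v := hK.sphereSupport_pos fun hzero =>
    hvolB (nonpos_iff_eq_zero.1 (hcK.trans_eq (withDensity_absolutelyContinuous _ _ hzero)))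
  obtain ⟨a, ha, ha', hEL⟩ :=
    exists_withDensity_eq_smul_gaussDualCurvature_of_isMinOn hp hq hK hcK hmin hpos
  refine ⟨K, hK, hpos, a, ha, ha', ?_⟩
  have hmeas : Measurable fun v => ENNReal.ofReal (sphereSupport K v ^ p) :=
    ((continuous_sphereSupport hK.isCompact hK.nonempty).measurable.pow_const p).ennreal_ofReal
  have hinv : (fun v => ENNReal.ofReal (sphereSupport K v ^ (-p))) =
      fun v => (ENNReal.ofReal (sphereSupport K v ^ p))⁻¹ := funext fun v => by
    rw [← ENNReal.ofReal_inv_of_pos (Real.rpow_pos_of_pos (hpos v) p),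
      Real.rpow_neg (hpos v).le]
  rw [← withDensity_smul_measure, ← hEL, hinv, withDensity_inv_same hmeas
    (Eventually.of_forall fun v => (ENNReal.ofReal_pos.2 (Real.rpow_pos_of_pos (hpos v) p)).ne')
    (Eventually.of_forall fun _ => ENNReal.ofReal_ne_top)]

end EulerLagrange

section CurvatureFormula

variable {E : Type*} [NormedAddCommGroup E] [InnerProductSpace ℝ E] [FiniteDimensional ℝ E]
  {H : sphere (0 : E) 1 → ℝ}

theorem frontier_wulffShape [Nontrivial E] (hH : Continuous H)
    (hpos : ∀ v, 0 < H v) : frontier (wulffShape H) = {x | wulffGauge H x = 1} := by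
  have hgauge := continuous_wulffGauge hH hpos
  have hW : wulffShape H = {x | wulffGauge H x ≤ 1} := Set.ext fun x => mem_wulffShape_iff hH hpos
  refine subset_antisymm (hW ▸ frontier_le_subset_eq hgauge continuous_const) fun x hx => ?_
  have hx : wulffGauge H x = 1 := hx
  refine ⟨subset_closure ((mem_wulffShape_iff hH hpos).2 hx.le), fun hinterior => ?_⟩
  have htendsto : Tendsto (fun t : ℝ => t • x) (𝓝[>] 1) (𝓝 x) :=
    ((continuous_id.smul continuous_const).tendsto' 1 x (one_smul ℝ x)).mono_left
      nhdsWithin_le_nhds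
  obtain ⟨t, htx, (ht : 1 < t)⟩ :=
    ((htendsto.eventually (mem_interior_iff_mem_nhds.1 hinterior)).and self_mem_nhdsWithin).exists
  have hle := (mem_wulffShape_iff hH hpos).1 htx
  rw [wulffGauge_smul (by positivity), hx, mul_one] at hle
  exact hle.not_gt ht

theorem inner_wulffNormal [Nontrivial E] (hH : Continuous H) (hpos : ∀ v, 0 < H v) {x : E}
    (hx : x ∈ wulffRegularBoundary H) : inner ℝ x (wulffNormal H x : E) = H (wulffNormal H x) := by
  rw [isNormalDir_wulffNormal hH hpos x, hx.1, one_mul]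

variable [MeasurableSpace E] [BorelSpace E]

theorem toSphere_setOf_inner_eq_zero {e : E} (he : e ≠ 0) :
    (volume : Measure E).toSphere {v | inner ℝ e (v : E) = 0} = 0 := by
  have hmeas : MeasurableSet {v : sphere (0 : E) 1 | inner ℝ e (v : E) = 0} :=
    (isClosed_eq (by fun_prop) continuous_const).measurableSet
  have hnull : volume ((ℝ ∙ e)ᗮ : Set E) = 0 :=
    Measure.addHaar_submodule volume _ fun htop => he <| by
      simpa using Submodule.mem_orthogonal_singleton_iff_inner_left.1
        (htop ▸ Submodule.mem_top : e ∈ (ℝ ∙ e)ᗮ)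
  rw [Measure.toSphere_apply' _ hmeas, measure_mono_null ?_ hnull, mul_zero]
  rintro _ ⟨r, -, _, ⟨v, hv, rfl⟩, rfl⟩
  exact Submodule.smul_mem _ r (Submodule.mem_orthogonal_singleton_iff_inner_right.2 hv)

variable [Nontrivial E] {p q : ℝ} {k : ℕ}

theorem measurable_indicator_comp_wulffNormal (hH : Continuous H) (hpos : ∀ v, 0 < H v)
    {g : sphere (0 : E) 1 → ℝ≥0∞} (hg : Measurable g) :
    Measurable ((wulffRegularBoundary H).indicator fun x => g (wulffNormal H x)) := by
  have hN : ContinuousOn (wulffNormal H) (wulffRegularBoundary H) :=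
    (continuousOn_wulffNormal hH hpos).mono fun _ hx => hx.2
  refine measurable_of_restrict_of_restrict_compl (measurableSet_wulffRegularBoundary hH hpos)
    ?_ ?_
  · convert hg.comp (continuousOn_iff_continuous_domRestrict.1 hN).measurable using 1
    ext x
    exact indicator_of_mem x.2 _
  · convert measurable_const (a := (0 : ℝ≥0∞)) using 1
    ext x
    exact indicator_of_notMem x.2 _

theorem measurableSet_wulffRegularBoundary_inter_preimage (hH : Continuous H)
    (hpos : ∀ v, 0 < H v) {η : Set (sphere (0 : E) 1)} (hη : MeasurableSet η) :
    MeasurableSet (wulffRegularBoundary H ∩ wulffNormal H ⁻¹' η) := by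
  have hN : ContinuousOn (wulffNormal H) (wulffRegularBoundary H) :=
    (continuousOn_wulffNormal hH hpos).mono fun _ hx => hx.2
  rw [← Subtype.image_preimage_coe]
  exact (measurableSet_wulffRegularBoundary hH hpos).subtype_image
    ((continuousOn_iff_continuous_domRestrict.1 hN).measurable hη)

theorem lintegral_gaussDualCurvature (hq : 0 < q) (hH : Continuous H) (hpos : ∀ v, 0 < H v)
    {g : sphere (0 : E) 1 → ℝ≥0∞} (hg : Measurable g) :
    ∫⁻ v, g v ∂gaussDualCurvature q H = ∫⁻ u : sphere (0 : E) 1,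
      ENNReal.ofReal (radialWeight q (wulffGauge H (u : E))⁻¹) * g (wulffNormal H (u : E))
        ∂(volume : Measure E).toSphere := by
  have hgN : AEMeasurable (fun u : sphere (0 : E) 1 => g (wulffNormal H (u : E)))
      (volume : Measure E).toSphere :=
    hg.comp_aemeasurable (aemeasurable_wulffNormal_coe hH hpos)
  have hN := aemeasurable_wulffNormal_coe_withDensity hH hpos fun u =>
    ENNReal.ofReal (radialWeight q (wulffGauge H (u : E))⁻¹)
  have hweight := (continuous_radialWeight_inv_wulffGauge hq hH hpos).measurable.ennreal_ofReal
  rw [gaussDualCurvature, lintegral_map' hg.aemeasurable hN,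
    lintegral_withDensity_eq_lintegral_mul₀ hweight.aemeasurable hgN]
  rfl

theorem setLIntegral_comp_wulffNormal (hE : Module.finrank ℝ E = k + 1) (hq : 0 < q)
    (hH : Continuous H) (hpos : ∀ v, 0 < H v) {g : sphere (0 : E) 1 → ℝ≥0∞} (hg : Measurable g) :
    ∫⁻ x in wulffRegularBoundary H, ENNReal.ofReal (H (wulffNormal H x)) *
        (ENNReal.ofReal (‖x‖ ^ (q - (k + 1)) * Real.exp (-(‖x‖ ^ 2) / 2)) * g (wulffNormal H x))
          ∂μHE[k] = ∫⁻ v, g v ∂gaussDualCurvature q H := by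
  rw [lintegral_gaussDualCurvature hq hH hpos hg, setLIntegral_wulffRegularBoundary hE hH hpos]
  · refine lintegral_congr_ae ?_
    filter_upwards [ae_toSphere_mem_regularDirs hH hpos] with u hu
    have hρ : 0 < (wulffGauge H (u : E))⁻¹ := inv_pos.2 (wulffGauge_coe_pos hH hpos u)
    set ρ := (wulffGauge H (u : E))⁻¹
    rw [wulffNormal_smul hH hpos hu hρ, ← mul_assoc, ← ENNReal.ofReal_mul (by positivity),
      norm_smul, norm_eq_of_mem_sphere, mul_one, Real.norm_of_nonneg hρ.le, ← mul_assoc,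
      radialWeight, ← Real.rpow_natCast, ← Real.rpow_add hρ]
    push_cast
    rw [add_sub_cancel]
  · have hweight : Measurable fun x : E =>
        ENNReal.ofReal (‖x‖ ^ (q - (k + 1)) * Real.exp (-(‖x‖ ^ 2) / 2)) := by fun_prop
    convert hweight.mul (measurable_indicator_comp_wulffNormal hH hpos hg) using 1
    exact funext fun x => indicator_mul_right _ _ _

theorem setLIntegral_curvatureIntegrand (hE : Module.finrank ℝ E = k + 1) (hq : 0 < q)
    (hH : Continuous H) (hpos : ∀ v, 0 < H v) {η : Set (sphere (0 : E) 1)}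
    (hη : MeasurableSet η) :
    ∫⁻ x in wulffRegularBoundary H ∩ wulffNormal H ⁻¹' η,
      ENNReal.ofReal (inner ℝ x (wulffNormal H x : E) ^ (1 - p) * ‖x‖ ^ (q - (k + 1)) *
        Real.exp (-(‖x‖ ^ 2) / 2)) ∂μHE[k] =
      (gaussDualCurvature q H).withDensity (fun v => ENNReal.ofReal (H v ^ (-p))) η := by
  set R := wulffRegularBoundary H
  have hR : MeasurableSet R := measurableSet_wulffRegularBoundary hH hpos
  have hN : AEMeasurable (wulffNormal H) (μHE[k].restrict R) :=
    ((continuousOn_wulffNormal hH hpos).mono fun _ hx => hx.2).aemeasurable hR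
  have hpre := hN.nullMeasurableSet_preimage hη
  have hg : Measurable fun v => ENNReal.ofReal (H v ^ (-p)) :=
    (hH.measurable.pow_const _).ennreal_ofReal
  rw [inter_comm, ← Measure.restrict_restrict₀ hpre, ← lintegral_indicator₀ hpre,
    withDensity_apply _ hη, ← lintegral_indicator hη,
    ← setLIntegral_comp_wulffNormal hE hq hH hpos (hg.indicator hη)]
  refine setLIntegral_congr_fun hR fun x hx => ?_
  by_cases hxη : wulffNormal H x ∈ η
  · have hHx := hpos (wulffNormal H x)
    rw [indicator_of_mem (mem_preimage.2 hxη), indicator_of_mem hxη, inner_wulffNormal hH hpos hx,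
      ← ENNReal.ofReal_mul (by positivity), ← ENNReal.ofReal_mul hHx.le, sub_eq_add_neg,
      Real.rpow_add hHx, Real.rpow_one]
    congr 1
    ring
  · rw [indicator_of_notMem (s := wulffNormal H ⁻¹' η) hxη, indicator_of_notMem hxη, mul_zero,
      mul_zero]

end CurvatureFormula

section DualCurvature

theorem exists_surfaceHausdorff_eq_smul (k : ℕ) :
    ∃ c : ℝ≥0∞, c ≠ 0 ∧ c ≠ ∞ ∧ surfaceHausdorff (k + 1) = c • μHE[k] := by
  set b := volume (ball (0 : EuclideanSpace ℝ (Fin k)) (1 / 2))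
  set s := (Measure.addHaarScalarFactor (volume : Measure (EuclideanSpace ℝ (Fin k))) μH[k] : ℝ≥0∞)
  have hs : s ≠ 0 := ENNReal.coe_ne_zero.2
    (Measure.addHaarScalarFactor_volume_hausdorffMeasure_ne_zero k)
  refine ⟨b * s⁻¹, mul_ne_zero (measure_ball_pos _ _ (by norm_num)).ne'
    (ENNReal.inv_ne_zero.2 ENNReal.coe_ne_top),
    ENNReal.mul_ne_top measure_ball_lt_top.ne (ENNReal.inv_ne_top.2 hs), ?_⟩
  have hdim : ((k + 1 : ℕ) : ℝ) - 1 = k := by push_cast; ring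
  rw [surfaceHausdorff, hdim, Measure.euclideanHausdorffMeasure_def, ENNReal.smul_def, smul_smul,
    mul_assoc, ENNReal.inv_mul_cancel hs ENNReal.coe_ne_top, mul_one]

variable {n : ℕ} {K : Set (EuclideanSpace ℝ (Fin n))}

theorem coe_mem_sphericalImage_iff {x : EuclideanSpace ℝ (Fin n)}
    (hx : wulffGauge (sphereSupport K) x = 1) {v : sphere (0 : EuclideanSpace ℝ (Fin n)) 1} :
    (v : EuclideanSpace ℝ (Fin n)) ∈ sphericalImage K x ↔ IsNormalDir (sphereSupport K) x v := by
  rw [IsNormalDir, hx, one_mul]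
  exact ⟨fun h => h.2, fun h => ⟨v.2, h⟩⟩

variable [NeZero n] (hK : IsSymmConvexCompact K) (hpos : ∀ v, 0 < sphereSupport K v)
include hK hpos

theorem regularBoundary_eq_wulffRegularBoundary :
    regularBoundary K = wulffRegularBoundary (sphereSupport K) := by
  have hfrontier : frontier K = {x | wulffGauge (sphereSupport K) x = 1} := by
    rw [← frontier_wulffShape (continuous_sphereSupport hK.isCompact hK.nonempty) hpos,
      wulffShape_sphereSupport hK.isCompact hK.convex hK.nonempty]
  ext x
  rw [regularBoundary, wulffRegularBoundary, mem_ofPred_eq, mem_ofPred_eq, hfrontier]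
  refine and_congr_right fun (hx : wulffGauge (sphereSupport K) x = 1) => ?_
  have hx0 : x ≠ 0 := by
    rintro rfl
    exact zero_ne_one (wulffGauge_zero.symm.trans hx)
  constructor
  · rintro ⟨v, hv, hunique⟩
    exact ⟨hx0, ⟨v, hv.1⟩, (coe_mem_sphericalImage_iff hx).1 hv, fun w hw =>
      Subtype.ext (hunique w ((coe_mem_sphericalImage_iff hx).2 hw))⟩
  · rintro ⟨-, v, hv, hunique⟩
    exact ⟨v, (coe_mem_sphericalImage_iff hx).2 hv, fun w hw => congrArg Subtype.val
      (hunique ⟨w, hw.1⟩ ((coe_mem_sphericalImage_iff hx).1 hw))⟩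

theorem gaussMap_eq_wulffNormal {x : EuclideanSpace ℝ (Fin n)}
    (hx : x ∈ wulffRegularBoundary (sphereSupport K)) :
    gaussMap K x = wulffNormal (sphereSupport K) x := by
  have hx' : x ∈ regularBoundary K := by rwa [regularBoundary_eq_wulffRegularBoundary hK hpos]
  rw [gaussMap, dif_pos hx']
  exact hx'.2.unique hx'.2.choose_spec.1 ((coe_mem_sphericalImage_iff hx.1).2
    (isNormalDir_wulffNormal (continuous_sphereSupport hK.isCompact hK.nonempty) hpos x))

theorem inverseGaussImage_eq_inter_preimage (η : Set (sphere (0 : EuclideanSpace ℝ (Fin n)) 1)) :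
    inverseGaussImage K η =
      wulffRegularBoundary (sphereSupport K) ∩ wulffNormal (sphereSupport K) ⁻¹' η := by
  ext x
  rw [inverseGaussImage, mem_ofPred_eq, regularBoundary_eq_wulffRegularBoundary hK hpos]
  refine and_congr_right fun hx => ?_
  rw [gaussMap_eq_wulffNormal hK hpos hx, Subtype.val_injective.mem_set_image]
  rfl

theorem exists_lpGaussianDualCurvature_eq {q : ℝ} (hq : 0 < q) (p : ℝ) :
    ∃ c : ℝ≥0∞, c ≠ 0 ∧ c ≠ ∞ ∧ ∀ η, MeasurableSet η → lpGaussianDualCurvature p q K η =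
      c * (gaussDualCurvature q (sphereSupport K)).withDensity
        (fun v => ENNReal.ofReal (sphereSupport K v ^ (-p))) η := by
  obtain ⟨k, rfl⟩ := Nat.exists_eq_succ_of_ne_zero (NeZero.ne n)
  obtain ⟨c, hc, hc', hsurface⟩ := exists_surfaceHausdorff_eq_smul k
  refine ⟨c, hc, hc', fun η hη => ?_⟩
  have hH := continuous_sphereSupport hK.isCompact hK.nonempty
  rw [lpGaussianDualCurvature, inverseGaussImage_eq_inter_preimage hK hpos, hsurface,
    Measure.restrict_smul, lintegral_smul_measure, smul_eq_mul,
    ← setLIntegral_curvatureIntegrand finrank_euclideanSpace_fin hq hH hpos hη]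
  congr 1
  refine setLIntegral_congr_fun
    (measurableSet_wulffRegularBoundary_inter_preimage hH hpos hη) fun x hx => ?_
  simp only [gaussMap_eq_wulffNormal hK hpos hx.1, Nat.cast_succ]

end DualCurvature

end

theorem theorem1p1_general (n : ℕ) [NeZero n] (p q : ℝ) (hp : 0 < p) (hq : 0 < q)
    (μ : Measure (sphere (0 : EuclideanSpace ℝ (Fin n)) 1)) [IsFiniteMeasure μ]
    [μ.IsNegInvariant] (hμ : ∀ e : EuclideanSpace ℝ (Fin n), e ≠ 0 →
      ∃ᵐ v : sphere (0 : EuclideanSpace ℝ (Fin n)) 1 ∂μ,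
        inner ℝ e (v : EuclideanSpace ℝ (Fin n)) ≠ 0) :
    ∃ K : ConvexBody (EuclideanSpace ℝ (Fin n)),
      (interior (K : Set (EuclideanSpace ℝ (Fin n)))).Nonempty ∧
      (∀ x ∈ K, -x ∈ K) ∧
      lpGaussianDualCurvature p q (K : Set (EuclideanSpace ℝ (Fin n))) Set.univ ≠ 0 ∧
      lpGaussianDualCurvature p q (K : Set (EuclideanSpace ℝ (Fin n))) Set.univ ≠ ∞ ∧
      ∀ η : Set (sphere (0 : EuclideanSpace ℝ (Fin n)) 1), MeasurableSet η →
        μ η / μ Set.univ =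
          lpGaussianDualCurvature p q (K : Set (EuclideanSpace ℝ (Fin n))) η /
            lpGaussianDualCurvature p q (K : Set (EuclideanSpace ℝ (Fin n))) Set.univ := by
  obtain ⟨K, hK, hpos, a, ha, ha', hμK⟩ := exists_eq_smul_gaussDualCurvature hp hq hμ
  obtain ⟨c, hc, hc', hcurv⟩ := exists_lpGaussianDualCurvature_eq hK hpos hq p
  set κ := (gaussDualCurvature q (sphereSupport K)).withDensity
    fun v => ENNReal.ofReal (sphereSupport K v ^ (-p))
  have hμκ : ∀ η, μ η = a * κ η := fun η => by rw [hμK]; rfl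
  have hμ0 : μ univ ≠ 0 := fun hzero => by
    obtain ⟨e, he⟩ := exists_ne (0 : EuclideanSpace ℝ (Fin n))
    exact hμ e he (by simp [Measure.measure_univ_eq_zero.1 hzero])
  have hκ0 : κ univ ≠ 0 := right_ne_zero_of_mul (hμκ univ ▸ hμ0)
  have hκtop : κ univ ≠ ∞ := fun htop =>
    measure_ne_top μ univ (by rw [hμκ, htop, ENNReal.mul_top ha])
  have hinterior : (interior K).Nonempty := by
    rw [← wulffShape_sphereSupport hK.isCompact hK.convex hK.nonempty]
    exact ⟨0, zero_mem_interior_wulffShape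
      (continuous_sphereSupport hK.isCompact hK.nonempty) hpos⟩
  refine ⟨⟨K, hK.convex, hK.isCompact, hK.nonempty⟩, hinterior, hK.neg_mem, ?_, ?_,
    fun η hη => ?_⟩ <;> rw [ConvexBody.coe_mk, hcurv _ MeasurableSet.univ]
  · exact mul_ne_zero hc hκ0
  · exact ENNReal.mul_ne_top hc' hκtop
  · rw [hcurv η hη, hμκ, hμκ, ENNReal.mul_div_mul_left _ _ ha ha',
      ENNReal.mul_div_mul_left _ _ hc hc']

theorem theorem1p1 (n : ℕ) (p q : ℝ) (hp : 0 < p) (hq : 0 < q)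
    (μ : Measure (sphere (0 : EuclideanSpace ℝ (Fin n)) 1)) [IsFiniteMeasure μ] (hμ : μ ≠ 0)
    (f : sphere (0 : EuclideanSpace ℝ (Fin n)) 1 → ℝ) (hf_meas : Measurable f)
    (hf_nonneg : ∀ v, 0 ≤ f v) (hf_even : ∀ v, f (-v) = f v)
    (hμf : μ = ((volume : Measure (EuclideanSpace ℝ (Fin n))).toSphere).withDensity
      (fun v => ENNReal.ofReal (f v))) :
    ∃ K : ConvexBody (EuclideanSpace ℝ (Fin n)),
      (interior (K : Set (EuclideanSpace ℝ (Fin n)))).Nonempty ∧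
      (∀ x ∈ K, -x ∈ K) ∧
      lpGaussianDualCurvature p q (K : Set (EuclideanSpace ℝ (Fin n))) Set.univ ≠ 0 ∧
      lpGaussianDualCurvature p q (K : Set (EuclideanSpace ℝ (Fin n))) Set.univ ≠ ∞ ∧
      ∀ η : Set (sphere (0 : EuclideanSpace ℝ (Fin n)) 1), MeasurableSet η →
        μ η / μ Set.univ =
          lpGaussianDualCurvature p q (K : Set (EuclideanSpace ℝ (Fin n))) η /
            lpGaussianDualCurvature p q (K : Set (EuclideanSpace ℝ (Fin n))) Set.univ := by
  have hn : NeZero n := ⟨by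
    rintro rfl
    exact hμ (Measure.eq_zero_of_isEmpty μ)⟩
  have := isNegInvariant_toSphere (E := EuclideanSpace ℝ (Fin n))
  have heven : μ.IsNegInvariant := hμf ▸ isNegInvariant_withDensity hf_meas.ennreal_ofReal
    fun v => by rw [hf_even]
  have := ae_neBot.2 hμ
  have habs : μ ≪ (volume : Measure (EuclideanSpace ℝ (Fin n))).toSphere :=
    hμf ▸ withDensity_absolutelyContinuous _ _
  exact theorem1p1_general n p q hp hq μ fun e he =>
    (measure_eq_zero_iff_ae_notMem.1 (habs (toSphere_setOf_inner_eq_zero he))).frequently
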